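/- **Theorem 5.1.** Let $\mathbb{H}$ be the real quaternions. For a matrix $A$ over $\mathbb{H}$ let $r(A)$ be its rank (the dimension of the right $\mathbb{H}$-space spanned by its columns), $A^{\dag}$ its Moore–Penrose inverse (the unique $X$ with $AXA=A$, $XAX=X$, $(AX)^*=AX$, $(XA)^*=XA$), $L_A=I-A^{\dag}A$ and $R_A=I-AA^{\dag}$. Let $A_i,B_i,C_i$ $(i=1,2,3,4)$ be given matrices over $\mathbb{H}$ of sizes such that the system $$A_1X_1-X_2B_1=C_1,\quad A_2X_2-X_3B_2=C_2,\quad A_3X_4-X_3B_3=C_3,\quad A_4X_5-X_4B_4=C_4 \qquad (\ast)$$ in the unknown matrices $X_1,\dots,X_5$ over $\mathbb{H}$ makes sense. Put $$A_{11}=R_{(A_2A_1)}A_2,\quad B_{11}=R_{B_1}L_{B_2},\quad C_{11}=R_{(A_2A_1)}(A_2R_{A_1}C_1B_1^{\dag}+C_2)L_{B_2},$$ $$A_{22}=R_{(A_3A_4)}A_3,\quad B_{22}=R_{B_4}L_{B_3},\quad C_{22}=R_{(A_3A_4)}(A_3R_{A_4}C_4B_4^{\dag}+C_3)L_{B_3},$$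 $$A_{33}=(A_2A_1,\ -A_3A_4),\quad B_{33}=\begin{pmatrix}R_{B_2}\\-R_{B_3}\end{pmatrix},\quad A_{44}=R_{B_{11}}R_{B_1}B_2^{\dag},\quad B_{44}=R_{B_{22}}R_{B_4}B_3^{\dag},$$ $$E_1=R_{(A_2A_1)}C_2B_2^{\dag}+A_{11}R_{A_1}C_1B_1^{\dag}B_2^{\dag}-C_{11}B_{11}^{\dag}R_{B_1}B_2^{\dag}-R_{(A_3A_4)}C_3B_3^{\dag}-A_{22}R_{A_4}C_4B_4^{\dag}B_3^{\dag}+C_{22}B_{22}^{\dag}R_{B_4}B_3^{\dag},$$ $$A=R_{A_{33}}A_{11},\quad B=A_{44}L_{B_{33}},\quad C=-R_{A_{33}}A_{22},\quad D=B_{44}L_{B_{33}},$$ $$E=R_{A_{33}}E_1L_{B_{33}},\quad M=R_AC,\quad N=DL_B,\quad S=CL_M.$$ Then the following statements are equivalent. (1) The system $(\ast)$ is consistent. (2) The following rank equalities hold: $$r\begin{pmatrix}C_i&A_i\\B_i&0\end{pmatrix}=r(A_i)+r(B_i)\quad(i=1,2,3,4),$$ $$r\begin{pmatrix}A_2C_1+C_2B_1&A_2A_1\\B_2B_1&0\end{pmatrix}=r(A_2A_1)+r(B_2B_1),\qquad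 r\begin{pmatrix}A_3C_4+C_3B_4&A_3A_4\\B_3B_4&0\end{pmatrix}=r(A_3A_4)+r(B_3B_4),$$ $$r\begin{pmatrix}C_2&C_3&A_2&A_3\\B_2&B_3&0&0\end{pmatrix}=r(A_2,\ A_3)+r(B_2,\ B_3),$$ $$r\begin{pmatrix}A_2C_1+C_2B_1&A_3C_4+C_3B_4&A_2A_1&A_3A_4\\B_2B_1&B_3B_4&0&0\end{pmatrix}=r(A_2A_1,\ A_3A_4)+r(B_2B_1,\ B_3B_4),$$ $$r\begin{pmatrix}C_2&A_3C_4+C_3B_4&A_2&A_3A_4\\B_2&B_3B_4&0&0\end{pmatrix}=r(A_2,\ A_3A_4)+r(B_2,\ B_3B_4),$$ $$r\begin{pmatrix}A_2C_1+C_2B_1&C_3&A_2A_1&A_3\\B_2B_1&B_3&0&0\end{pmatrix}=r(A_2A_1,\ A_3)+r(B_2B_1,\ B_3).$$ (3) The following equalities hold: $$R_{A_1}C_1L_{B_1}=0,\quad R_{A_{11}}C_{11}=0,\quad C_{11}L_{B_{11}}=0,\qquad R_{A_4}C_4L_{B_4}=0,\quad R_{A_{22}}C_{22}=0,\quad C_{22}L_{B_{22}}=0,$$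 $$R_MR_AE=0,\quad EL_BL_N=0,\quad R_AEL_D=0,\quad R_CEL_B=0.$$ In this case, $(X_1,\dots,X_5)$ is a solution of $(\ast)$ if and only if it is given, for some matrices $W_1,W_2,W_6,T_1,T_2,T_6,Z_1,\dots,Z_8$ over $\mathbb{H}$ of appropriate sizes, by $$X_1=A_1^{\dag}C_1+U_1B_1+L_{A_1}W_1,\qquad X_2=-R_{A_1}C_1B_1^{\dag}+A_1U_1+V_1R_{B_1},$$ $$X_4=-R_{A_4}C_4B_4^{\dag}+A_4U_2+V_2R_{B_4},\qquad X_5=A_4^{\dag}C_4+U_2B_4+L_{A_4}T_1,$$ $$X_3=-R_{(A_2A_1)}(C_2+A_2R_{A_1}C_1B_1^{\dag}-A_2V_1R_{B_1})B_2^{\dag}+A_2A_1W_4+W_5R_{B_2},$$ and for all values of these arbitrary matrices the last expression is equal to $$-R_{(A_3A_4)}(C_3+A_3R_{A_4}C_4B_4^{\dag}-A_3V_2R_{B_4})B_3^{\dag}+A_3A_4T_4+T_5R_{B_3},$$ so that either of the two may be used for $X_3$. Here $$V_1=A_{11}^{\dag}C_{11}B_{11}^{\dag}+L_{A_{11}}W_2+W_3R_{B_{11}},\qquad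 V_2=A_{22}^{\dag}C_{22}B_{22}^{\dag}+L_{A_{22}}T_2+T_3R_{B_{22}},$$ $$U_1=(A_2A_1)^{\dag}(C_2+A_2R_{A_1}C_1B_1^{\dag}-A_2V_1R_{B_1})+W_4B_2+L_{(A_2A_1)}W_6,$$ $$U_2=(A_3A_4)^{\dag}(C_3+A_3R_{A_4}C_4B_4^{\dag}-A_3V_2R_{B_4})+T_4B_3+L_{(A_3A_4)}T_6,$$ $$W_4=(I_{p_1},\ 0)\,G,\quad T_4=(0,\ I_{p_2})\,G,\quad W_5=H\begin{pmatrix}I_{p_3}\\0\end{pmatrix},\quad T_5=H\begin{pmatrix}0\\I_{p_4}\end{pmatrix},$$ $$G=A_{33}^{\dag}(E_1-A_{11}W_3A_{44}+A_{22}T_3B_{44})-A_{33}^{\dag}Z_7B_{33}+L_{A_{33}}Z_6,$$ $$H=R_{A_{33}}(E_1-A_{11}W_3A_{44}+A_{22}T_3B_{44})B_{33}^{\dag}+A_{33}A_{33}^{\dag}Z_7+Z_8R_{B_{33}},$$ $$W_3=A^{\dag}EB^{\dag}-A^{\dag}CM^{\dag}EB^{\dag}-A^{\dag}SC^{\dag}EN^{\dag}DB^{\dag}-A^{\dag}SZ_1R_NDB^{\dag}+L_AZ_2+Z_3R_B,$$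 $$T_3=M^{\dag}ED^{\dag}+S^{\dag}SC^{\dag}EN^{\dag}+L_ML_SZ_4+L_MZ_1R_N+Z_5R_D,$$ where $p_1,p_2$ are the numbers of columns of $A_1,A_4$, and $p_3,p_4$ are the numbers of rows of $B_2,B_3$. -/

import Mathlib

open Matrix
open scoped Quaternion

namespace QuatMatrix

section MoorePenrose

variable {m n : Type*} [Fintype m] [Fintype n]

/-- `X` satisfies the four Penrose equations for the real quaternion matrix `A`. -/
structure IsMoorePenrose (A : Matrix m n ℍ[ℝ]) (X : Matrix n m ℍ[ℝ]) : Prop where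
  mul_mul_self : A * X * A = A
  mul_mul_inv : X * A * X = X
  conjTranspose_self_mul : (A * X)ᴴ = A * X
  conjTranspose_mul_self : (X * A)ᴴ = X * A

theorem eq_zero_of_conjTranspose_mul_self {m n : Type*} [Fintype m] (Y : Matrix m n ℍ[ℝ]) (h : Yᴴ * Y = 0) : Y = 0 := by
  ext1 i j
  have h1 : ∑ k, star (Y k j) * Y k j = 0 := by
    have := congrFun (congrFun h j) j
    simpa [Matrix.mul_apply] using this
  have h2 : ∑ k, Quaternion.normSq (Y k j) = 0 := by
    have h3 : ((∑ k, Quaternion.normSq (Y k j) : ℝ) : ℍ[ℝ]) = 0 := by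
      rw [← h1]
      simp only [Quaternion.star_mul_self]
      exact map_sum (algebraMap ℝ ℍ[ℝ]) _ _
    exact Quaternion.coe_injective (h3.trans Quaternion.coe_zero.symm)
  have h4 := (Finset.sum_eq_zero_iff_of_nonneg
    (fun k _ => Quaternion.normSq_nonneg)).1 h2 i (Finset.mem_univ i)
  simpa using h4

theorem IsMoorePenrose.unique {A : Matrix m n ℍ[ℝ]} {X Y : Matrix n m ℍ[ℝ]}
    (hX : IsMoorePenrose A X) (hY : IsMoorePenrose A Y) : X = Y := by
  have h1 : A * X = A * Y := by
    calc A * X = (A * X)ᴴ := hX.conjTranspose_self_mul.symm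
      _ = ((A * Y) * (A * X))ᴴ := by
        rw [← Matrix.mul_assoc, hY.mul_mul_self]
      _ = (A * X) * (A * Y) := by
        rw [conjTranspose_mul, hX.conjTranspose_self_mul, hY.conjTranspose_self_mul]
      _ = A * Y := by rw [← Matrix.mul_assoc, hX.mul_mul_self]
  have h2 : X * A = Y * A := by
    calc X * A = (X * A)ᴴ := hX.conjTranspose_mul_self.symm
      _ = ((X * A) * (Y * A))ᴴ := by
        rw [Matrix.mul_assoc X A, ← Matrix.mul_assoc A Y, hY.mul_mul_self]
      _ = (Y * A) * (X * A) := by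
        rw [conjTranspose_mul, hX.conjTranspose_mul_self, hY.conjTranspose_mul_self]
      _ = Y * A := by rw [Matrix.mul_assoc Y A, ← Matrix.mul_assoc A X, hX.mul_mul_self]
  calc X = X * A * X := hX.mul_mul_inv.symm
    _ = Y * A * Y := by rw [h2, Matrix.mul_assoc, h1, ← Matrix.mul_assoc]
    _ = Y := hY.mul_mul_inv

theorem exists_isMoorePenrose (A : Matrix m n ℍ[ℝ]) :
    ∃ X : Matrix n m ℍ[ℝ], IsMoorePenrose A X := by
  classical
  set G : Matrix n n ℍ[ℝ] := Aᴴ * A with hG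
  have hGs : Gᴴ = G := by simp [hG, conjTranspose_mul]
  have hGY : ∀ Y : Matrix n n ℍ[ℝ], G * (G * Y) = 0 → G * Y = 0 := by
    intro Y hY
    apply eq_zero_of_conjTranspose_mul_self
    rw [conjTranspose_mul, hGs, Matrix.mul_assoc, hY, Matrix.mul_zero]
  have hpow : ∀ (k : ℕ) (Y : Matrix n n ℍ[ℝ]), G ^ k * Y = 0 → G * Y = 0 := by
    intro k
    induction k with
    | zero => intro Y hY; rw [pow_zero, Matrix.one_mul] at hY; rw [hY, Matrix.mul_zero]
    | succ k ih =>
      intro Y hY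
      apply hGY
      apply ih
      rw [← Matrix.mul_assoc, ← pow_succ, hY]
  have hsm : ∀ (c : ℝ) (Y : Matrix n n ℍ[ℝ]), (c • Y)ᴴ = c • Yᴴ := by
    intro c Y
    ext1 i j
    simp [conjTranspose_apply]
  obtain ⟨H, hHs, hHG, hH⟩ :
      ∃ H : Matrix n n ℍ[ℝ], Hᴴ = H ∧ H * G = G * H ∧ G * (H * G) = G := by
    obtain ⟨p, hpm, hp⟩ := Algebra.IsIntegral.isIntegral (R := ℝ) G
    have hp' : Polynomial.aeval G p = 0 := hp
    obtain ⟨q, hq, hnd⟩ :=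
      Polynomial.exists_eq_pow_rootMultiplicity_mul_and_not_dvd p hpm.ne_zero 0
    simp only [map_zero, sub_zero] at hq hnd
    rw [Polynomial.X_dvd_iff] at hnd
    rw [hq, map_mul, map_pow, Polynomial.aeval_X] at hp'
    have h1 := hpow _ _ hp'
    have h2 : Polynomial.aeval G q
        = Polynomial.aeval G q.divX * G + algebraMap ℝ _ (q.coeff 0) := by
      conv_lhs => rw [← Polynomial.divX_mul_X_add q]
      simp
    have hstar : ∀ r : Polynomial ℝ, (Polynomial.aeval G r)ᴴ = Polynomial.aeval G r := by
      intro r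
      induction r using Polynomial.induction_on' with
      | add a b ha hb => simp [ha, hb]
      | monomial k c =>
        rw [Polynomial.aeval_monomial, ← Algebra.smul_def, hsm,
          conjTranspose_pow, hGs]
    refine ⟨-(q.coeff 0)⁻¹ • Polynomial.aeval G q.divX, ?_, ?_, ?_⟩
    · rw [hsm, hstar]
    · have hc : Polynomial.aeval G q.divX * G = G * Polynomial.aeval G q.divX := by
        have := congrArg (Polynomial.aeval G) (mul_comm q.divX Polynomial.X)
        simpa using this
      rw [Matrix.smul_mul, Matrix.mul_smul, hc]
    · rw [h2, Matrix.mul_add, ← Algebra.commutes, ← Algebra.smul_def] at h1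
      rw [Matrix.smul_mul, Matrix.mul_smul, eq_neg_of_add_eq_zero_left h1, smul_neg, neg_smul,
        neg_neg, smul_smul, inv_mul_cancel₀ hnd, one_smul]
  have hA : A * (H * Aᴴ) * A = A := by
    have h0 : A * (H * G) - A = 0 := by
      apply eq_zero_of_conjTranspose_mul_self
      have h3 : Aᴴ * (A * (H * G) - A) = 0 := by
        rw [Matrix.mul_sub, ← Matrix.mul_assoc, ← hG, hH, sub_self]
      rw [conjTranspose_sub, Matrix.sub_mul, h3, sub_zero, conjTranspose_mul, Matrix.mul_assoc, h3,
        Matrix.mul_zero]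
    rw [Matrix.mul_assoc, Matrix.mul_assoc, ← hG]
    exact sub_eq_zero.1 h0
  have hAX : (A * (H * Aᴴ))ᴴ = A * (H * Aᴴ) := by
    simp [conjTranspose_mul, hHs, Matrix.mul_assoc]
  have hXA : (H * Aᴴ * A)ᴴ = H * Aᴴ * A := by
    rw [Matrix.mul_assoc, ← hG, conjTranspose_mul, hHs, hGs, hHG]
  set X : Matrix n m ℍ[ℝ] := H * Aᴴ with hX
  clear_value X
  have e1 : A * (X * A * X) = A * X := by
    rw [← Matrix.mul_assoc, ← Matrix.mul_assoc, hA]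
  have e2 : X * A * X * A = X * A := by
    rw [Matrix.mul_assoc, Matrix.mul_assoc, ← Matrix.mul_assoc A, hA]
  refine ⟨X * A * X, ?_, ?_, ?_, ?_⟩
  · rw [e1, hA]
  · rw [e2, Matrix.mul_assoc, e1, ← Matrix.mul_assoc]
  · rw [e1, hAX]
  · rw [e2, hXA]

/-- The Moore-Penrose inverse of a real quaternion matrix: the unique matrix satisfying the four
Penrose equations. -/
noncomputable def mpInv (A : Matrix m n ℍ[ℝ]) : Matrix n m ℍ[ℝ] :=
  (exists_isMoorePenrose A).choose

theorem isMoorePenrose_mpInv (A : Matrix m n ℍ[ℝ]) : IsMoorePenrose A (mpInv A) :=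
  (exists_isMoorePenrose A).choose_spec

/-- The projector `I - A† A`. -/
noncomputable def projL [DecidableEq n] (A : Matrix m n ℍ[ℝ]) : Matrix n n ℍ[ℝ] :=
  1 - mpInv A * A

/-- The projector `I - A A†`. -/
noncomputable def projR [DecidableEq m] (A : Matrix m n ℍ[ℝ]) : Matrix m m ℍ[ℝ] :=
  1 - A * mpInv A

end MoorePenrose

/-- The rank of a real quaternion matrix: the dimension of the right `ℍ`-vector space spanned by
its columns, that is, the maximal number of right linearly independent columns.  A right
`ℍ`-vector space is a module over the opposite ring. -/
noncomputable def rank {m n : Type*} (A : Matrix m n ℍ[ℝ]) : ℕ :=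
  Module.finrank ℍ[ℝ]ᵐᵒᵖ (Submodule.span ℍ[ℝ]ᵐᵒᵖ (Set.range A.col))

end QuatMatrix

open QuatMatrix

postfix:max "†" => mpInv

/-- The coefficients of the system
`A₁ X₁ - X₂ B₁ = C₁`, `A₂ X₂ - X₃ B₂ = C₂`, `A₃ X₄ - X₃ B₃ = C₃`, `A₄ X₅ - X₄ B₄ = C₄`
in unknowns `Xᵢ` of size `aᵢ × bᵢ`. -/
structure CoupledSystem (a₁ a₂ a₃ a₄ a₅ b₁ b₂ b₃ b₄ b₅ : ℕ) where
  A₁ : Matrix (Fin a₂) (Fin a₁) ℍ[ℝ]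
  B₁ : Matrix (Fin b₂) (Fin b₁) ℍ[ℝ]
  C₁ : Matrix (Fin a₂) (Fin b₁) ℍ[ℝ]
  A₂ : Matrix (Fin a₃) (Fin a₂) ℍ[ℝ]
  B₂ : Matrix (Fin b₃) (Fin b₂) ℍ[ℝ]
  C₂ : Matrix (Fin a₃) (Fin b₂) ℍ[ℝ]
  A₃ : Matrix (Fin a₃) (Fin a₄) ℍ[ℝ]
  B₃ : Matrix (Fin b₃) (Fin b₄) ℍ[ℝ]
  C₃ : Matrix (Fin a₃) (Fin b₄) ℍ[ℝ]
  A₄ : Matrix (Fin a₄) (Fin a₅) ℍ[ℝ]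
  B₄ : Matrix (Fin b₄) (Fin b₅) ℍ[ℝ]
  C₄ : Matrix (Fin a₄) (Fin b₅) ℍ[ℝ]

/-- The arbitrary matrices in the general solution. -/
structure FreeParameters (a₁ a₂ a₃ a₄ a₅ b₁ b₂ b₃ b₄ b₅ : ℕ) where
  W₁ : Matrix (Fin a₁) (Fin b₁) ℍ[ℝ]
  W₂ : Matrix (Fin a₂) (Fin b₂) ℍ[ℝ]
  W₆ : Matrix (Fin a₁) (Fin b₂) ℍ[ℝ]
  T₁ : Matrix (Fin a₅) (Fin b₅) ℍ[ℝ]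
  T₂ : Matrix (Fin a₄) (Fin b₄) ℍ[ℝ]
  T₆ : Matrix (Fin a₅) (Fin b₄) ℍ[ℝ]
  Z₁ : Matrix (Fin a₄) (Fin b₄) ℍ[ℝ]
  Z₂ : Matrix (Fin a₂) (Fin b₂) ℍ[ℝ]
  Z₃ : Matrix (Fin a₂) (Fin b₂) ℍ[ℝ]
  Z₄ : Matrix (Fin a₄) (Fin b₄) ℍ[ℝ]
  Z₅ : Matrix (Fin a₄) (Fin b₄) ℍ[ℝ]
  Z₆ : Matrix (Fin a₁ ⊕ Fin a₅) (Fin b₃) ℍ[ℝ]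
  Z₇ : Matrix (Fin a₃) (Fin b₃ ⊕ Fin b₃) ℍ[ℝ]
  Z₈ : Matrix (Fin a₃) (Fin b₃ ⊕ Fin b₃) ℍ[ℝ]

namespace CoupledSystem

variable {a₁ a₂ a₃ a₄ a₅ b₁ b₂ b₃ b₄ b₅ : ℕ}
variable (s : CoupledSystem a₁ a₂ a₃ a₄ a₅ b₁ b₂ b₃ b₄ b₅)
variable (p : FreeParameters a₁ a₂ a₃ a₄ a₅ b₁ b₂ b₃ b₄ b₅)

def IsSolution (X₁ : Matrix (Fin a₁) (Fin b₁) ℍ[ℝ]) (X₂ : Matrix (Fin a₂) (Fin b₂) ℍ[ℝ])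
    (X₃ : Matrix (Fin a₃) (Fin b₃) ℍ[ℝ]) (X₄ : Matrix (Fin a₄) (Fin b₄) ℍ[ℝ])
    (X₅ : Matrix (Fin a₅) (Fin b₅) ℍ[ℝ]) : Prop :=
  s.A₁ * X₁ - X₂ * s.B₁ = s.C₁ ∧ s.A₂ * X₂ - X₃ * s.B₂ = s.C₂ ∧
  s.A₃ * X₄ - X₃ * s.B₃ = s.C₃ ∧ s.A₄ * X₅ - X₄ * s.B₄ = s.C₄

def Consistent : Prop :=
  ∃ X₁ X₂ X₃ X₄ X₅, s.IsSolution X₁ X₂ X₃ X₄ X₅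

/-- The block matrix `(C₂ C₃)` and its analogues are `fromCols`; the block matrix
`(C A; B 0)` is `fromBlocks C A B 0`. -/
def RankConditions : Prop :=
  rank (fromBlocks s.C₁ s.A₁ s.B₁ 0) = rank s.A₁ + rank s.B₁ ∧
  rank (fromBlocks s.C₂ s.A₂ s.B₂ 0) = rank s.A₂ + rank s.B₂ ∧
  rank (fromBlocks s.C₃ s.A₃ s.B₃ 0) = rank s.A₃ + rank s.B₃ ∧
  rank (fromBlocks s.C₄ s.A₄ s.B₄ 0) = rank s.A₄ + rank s.B₄ ∧
  rank (fromBlocks (s.A₂ * s.C₁ + s.C₂ * s.B₁) (s.A₂ * s.A₁) (s.B₂ * s.B₁) 0) =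
    rank (s.A₂ * s.A₁) + rank (s.B₂ * s.B₁) ∧
  rank (fromBlocks (s.A₃ * s.C₄ + s.C₃ * s.B₄) (s.A₃ * s.A₄) (s.B₃ * s.B₄) 0) =
    rank (s.A₃ * s.A₄) + rank (s.B₃ * s.B₄) ∧
  rank (fromBlocks (fromCols s.C₂ s.C₃) (fromCols s.A₂ s.A₃) (fromCols s.B₂ s.B₃) 0) =
    rank (fromCols s.A₂ s.A₃) + rank (fromCols s.B₂ s.B₃) ∧
  rank (fromBlocks (fromCols (s.A₂ * s.C₁ + s.C₂ * s.B₁) (s.A₃ * s.C₄ + s.C₃ * s.B₄))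
      (fromCols (s.A₂ * s.A₁) (s.A₃ * s.A₄)) (fromCols (s.B₂ * s.B₁) (s.B₃ * s.B₄)) 0) =
    rank (fromCols (s.A₂ * s.A₁) (s.A₃ * s.A₄)) + rank (fromCols (s.B₂ * s.B₁) (s.B₃ * s.B₄)) ∧
  rank (fromBlocks (fromCols s.C₂ (s.A₃ * s.C₄ + s.C₃ * s.B₄))
      (fromCols s.A₂ (s.A₃ * s.A₄)) (fromCols s.B₂ (s.B₃ * s.B₄)) 0) =
    rank (fromCols s.A₂ (s.A₃ * s.A₄)) + rank (fromCols s.B₂ (s.B₃ * s.B₄)) ∧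
  rank (fromBlocks (fromCols (s.A₂ * s.C₁ + s.C₂ * s.B₁) s.C₃)
      (fromCols (s.A₂ * s.A₁) s.A₃) (fromCols (s.B₂ * s.B₁) s.B₃) 0) =
    rank (fromCols (s.A₂ * s.A₁) s.A₃) + rank (fromCols (s.B₂ * s.B₁) s.B₃)

noncomputable def A₁₁ := projR (s.A₂ * s.A₁) * s.A₂
noncomputable def B₁₁ := projR s.B₁ * projL s.B₂
noncomputable def C₁₁ :=
  projR (s.A₂ * s.A₁) * (s.A₂ * projR s.A₁ * s.C₁ * s.B₁† + s.C₂) * projL s.B₂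
noncomputable def A₂₂ := projR (s.A₃ * s.A₄) * s.A₃
noncomputable def B₂₂ := projR s.B₄ * projL s.B₃
noncomputable def C₂₂ :=
  projR (s.A₃ * s.A₄) * (s.A₃ * projR s.A₄ * s.C₄ * s.B₄† + s.C₃) * projL s.B₃
noncomputable def A₃₃ := fromCols (s.A₂ * s.A₁) (-(s.A₃ * s.A₄))
noncomputable def B₃₃ := fromRows (projR s.B₂) (-projR s.B₃)
noncomputable def A₄₄ := projR s.B₁₁ * projR s.B₁ * s.B₂†
noncomputable def B₄₄ := projR s.B₂₂ * projR s.B₄ * s.B₃†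
noncomputable def E₁ :=
  projR (s.A₂ * s.A₁) * s.C₂ * s.B₂† + s.A₁₁ * projR s.A₁ * s.C₁ * s.B₁† * s.B₂†
    - s.C₁₁ * s.B₁₁† * projR s.B₁ * s.B₂†
    - projR (s.A₃ * s.A₄) * s.C₃ * s.B₃† - s.A₂₂ * projR s.A₄ * s.C₄ * s.B₄† * s.B₃†
    + s.C₂₂ * s.B₂₂† * projR s.B₄ * s.B₃†
noncomputable def A := projR s.A₃₃ * s.A₁₁
noncomputable def B := s.A₄₄ * projL s.B₃₃
noncomputable def C := -(projR s.A₃₃) * s.A₂₂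
noncomputable def D := s.B₄₄ * projL s.B₃₃
noncomputable def E := projR s.A₃₃ * s.E₁ * projL s.B₃₃
noncomputable def M := projR s.A * s.C
noncomputable def N := s.D * projL s.B
noncomputable def S := s.C * projL s.M

def ProjectorConditions : Prop :=
  (projR s.A₁ * s.C₁ * projL s.B₁ = 0 ∧ projR s.A₁₁ * s.C₁₁ = 0 ∧ s.C₁₁ * projL s.B₁₁ = 0) ∧
  (projR s.A₄ * s.C₄ * projL s.B₄ = 0 ∧ projR s.A₂₂ * s.C₂₂ = 0 ∧ s.C₂₂ * projL s.B₂₂ = 0) ∧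
  (projR s.M * projR s.A * s.E = 0 ∧ s.E * projL s.B * projL s.N = 0 ∧
    projR s.A * s.E * projL s.D = 0 ∧ projR s.C * s.E * projL s.B = 0)

noncomputable def W₃ : Matrix (Fin a₂) (Fin b₂) ℍ[ℝ] :=
  s.A† * s.E * s.B† - s.A† * s.C * s.M† * s.E * s.B†
    - s.A† * s.S * s.C† * s.E * s.N† * s.D * s.B†
    - s.A† * s.S * p.Z₁ * projR s.N * s.D * s.B† + projL s.A * p.Z₂ + p.Z₃ * projR s.B
noncomputable def T₃ : Matrix (Fin a₄) (Fin b₄) ℍ[ℝ] :=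
  s.M† * s.E * s.D† + s.S† * s.S * s.C† * s.E * s.N† + projL s.M * projL s.S * p.Z₄
    + projL s.M * p.Z₁ * projR s.N + p.Z₅ * projR s.D
noncomputable def W₄ : Matrix (Fin a₁) (Fin b₃) ℍ[ℝ] :=
  fromCols (1 : Matrix (Fin a₁) (Fin a₁) ℍ[ℝ]) (0 : Matrix (Fin a₁) (Fin a₅) ℍ[ℝ]) *
    (s.A₃₃† * (s.E₁ - s.A₁₁ * s.W₃ p * s.A₄₄ + s.A₂₂ * s.T₃ p * s.B₄₄)
      - s.A₃₃† * p.Z₇ * s.B₃₃ + projL s.A₃₃ * p.Z₆)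
noncomputable def T₄ : Matrix (Fin a₅) (Fin b₃) ℍ[ℝ] :=
  fromCols (0 : Matrix (Fin a₅) (Fin a₁) ℍ[ℝ]) (1 : Matrix (Fin a₅) (Fin a₅) ℍ[ℝ]) *
    (s.A₃₃† * (s.E₁ - s.A₁₁ * s.W₃ p * s.A₄₄ + s.A₂₂ * s.T₃ p * s.B₄₄)
      - s.A₃₃† * p.Z₇ * s.B₃₃ + projL s.A₃₃ * p.Z₆)
noncomputable def W₅ : Matrix (Fin a₃) (Fin b₃) ℍ[ℝ] :=
  (projR s.A₃₃ * (s.E₁ - s.A₁₁ * s.W₃ p * s.A₄₄ + s.A₂₂ * s.T₃ p * s.B₄₄) * s.B₃₃†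
      + s.A₃₃ * s.A₃₃† * p.Z₇ + p.Z₈ * projR s.B₃₃) *
    fromRows (1 : Matrix (Fin b₃) (Fin b₃) ℍ[ℝ]) (0 : Matrix (Fin b₃) (Fin b₃) ℍ[ℝ])
noncomputable def T₅ : Matrix (Fin a₃) (Fin b₃) ℍ[ℝ] :=
  (projR s.A₃₃ * (s.E₁ - s.A₁₁ * s.W₃ p * s.A₄₄ + s.A₂₂ * s.T₃ p * s.B₄₄) * s.B₃₃†
      + s.A₃₃ * s.A₃₃† * p.Z₇ + p.Z₈ * projR s.B₃₃) *
    fromRows (0 : Matrix (Fin b₃) (Fin b₃) ℍ[ℝ]) (1 : Matrix (Fin b₃) (Fin b₃) ℍ[ℝ])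
noncomputable def V₁ : Matrix (Fin a₂) (Fin b₂) ℍ[ℝ] :=
  s.A₁₁† * s.C₁₁ * s.B₁₁† + projL s.A₁₁ * p.W₂ + s.W₃ p * projR s.B₁₁
noncomputable def U₁ : Matrix (Fin a₁) (Fin b₂) ℍ[ℝ] :=
  (s.A₂ * s.A₁)† * (s.C₂ + s.A₂ * projR s.A₁ * s.C₁ * s.B₁† - s.A₂ * s.V₁ p * projR s.B₁)
    + s.W₄ p * s.B₂ + projL (s.A₂ * s.A₁) * p.W₆
noncomputable def V₂ : Matrix (Fin a₄) (Fin b₄) ℍ[ℝ] :=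
  s.A₂₂† * s.C₂₂ * s.B₂₂† + projL s.A₂₂ * p.T₂ + s.T₃ p * projR s.B₂₂
noncomputable def U₂ : Matrix (Fin a₅) (Fin b₄) ℍ[ℝ] :=
  (s.A₃ * s.A₄)† * (s.C₃ + s.A₃ * projR s.A₄ * s.C₄ * s.B₄† - s.A₃ * s.V₂ p * projR s.B₄)
    + s.T₄ p * s.B₃ + projL (s.A₃ * s.A₄) * p.T₆

noncomputable def X₁ : Matrix (Fin a₁) (Fin b₁) ℍ[ℝ] :=
  s.A₁† * s.C₁ + s.U₁ p * s.B₁ + projL s.A₁ * p.W₁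
noncomputable def X₂ : Matrix (Fin a₂) (Fin b₂) ℍ[ℝ] :=
  -(projR s.A₁) * s.C₁ * s.B₁† + s.A₁ * s.U₁ p + s.V₁ p * projR s.B₁
noncomputable def X₄ : Matrix (Fin a₄) (Fin b₄) ℍ[ℝ] :=
  -(projR s.A₄) * s.C₄ * s.B₄† + s.A₄ * s.U₂ p + s.V₂ p * projR s.B₄
noncomputable def X₅ : Matrix (Fin a₅) (Fin b₅) ℍ[ℝ] :=
  s.A₄† * s.C₄ + s.U₂ p * s.B₄ + projL s.A₄ * p.T₁
/-- The first of the two expressions for the third unknown. -/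
noncomputable def X₃ : Matrix (Fin a₃) (Fin b₃) ℍ[ℝ] :=
  -(projR (s.A₂ * s.A₁)) *
      (s.C₂ + s.A₂ * projR s.A₁ * s.C₁ * s.B₁† - s.A₂ * s.V₁ p * projR s.B₁) * s.B₂†
    + s.A₂ * s.A₁ * s.W₄ p + s.W₅ p * projR s.B₂
/-- The second of the two expressions for the third unknown. -/
noncomputable def X₃Alt : Matrix (Fin a₃) (Fin b₃) ℍ[ℝ] :=
  -(projR (s.A₃ * s.A₄)) *
      (s.C₃ + s.A₃ * projR s.A₄ * s.C₄ * s.B₄† - s.A₃ * s.V₂ p * projR s.B₄) * s.B₃†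
    + s.A₃ * s.A₄ * s.T₄ p + s.T₅ p * projR s.B₃

end CoupledSystem

/-! The unknowns form a chain linked at `X₃`, so the system splits into two halves of the same
shape, exchanged by `swap`. In one half, the first equation is a Sylvester equation, solved with
parameters `U` and `V`. Substitution turns the second into a Sylvester equation in `U` and `X₃`,
solvable exactly when `A₁₁ V B₁₁ = C₁₁`. Equating the two resulting expressions for `X₃` gives one
more Sylvester equation, in block unknowns, solvable exactly when `A W₃ B + C T₃ D = E`. This last
equation is handled by `twoSided_of_solvability` and `twoSided_left_right_eq`. The parametrisations
are complete because a given solution, or a projection of it, can serve as its own parameters. The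
ranks enter through `rank_fromBlocks_zero_eq_add_iff_projR_mul_mul_projL`: each rank equality says
`P C Q = 0` whenever `P A = 0` and `B Q = 0`. Consistency gives all ten, since each block matrix
belongs to a Sylvester equation satisfied by the `Xᵢ`. Conversely, `mul_E₁_mul_eq_zero` derives the
four conditions on `E` from the four mixed rank equalities, one for each way of annihilating the two
halves. -/

namespace QuatMatrix

/-! ### Rank over right quaternionic spaces -/

section Rank

variable {m n p q : Type*} [Fintype n] [Fintype q]

instance : Module.Finite ℍ[ℝ]ᵐᵒᵖ ℍ[ℝ] := by
  refine ⟨⟨{1}, ?_⟩⟩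
  rw [Finset.coe_singleton, eq_top_iff]
  intro x _
  exact Submodule.mem_span_singleton.2 ⟨MulOpposite.op x, by simp⟩

/-- Left multiplication of column vectors by `A`, as a map of right `ℍ`-spaces. -/
noncomputable def mulVecRight (A : Matrix m n ℍ[ℝ]) : (n → ℍ[ℝ]) →ₗ[ℍ[ℝ]ᵐᵒᵖ] (m → ℍ[ℝ]) where
  toFun v := A *ᵥ v
  map_add' := A.mulVec_add
  map_smul' c v := A.mulVec_smul c v

@[simp]
theorem mulVecRight_apply (A : Matrix m n ℍ[ℝ]) (v : n → ℍ[ℝ]) : mulVecRight A v = A *ᵥ v := rfl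

theorem range_mulVecRight (A : Matrix m n ℍ[ℝ]) :
    LinearMap.range (mulVecRight A) = Submodule.span ℍ[ℝ]ᵐᵒᵖ (Set.range A.col) := by
  classical
  apply le_antisymm
  · rintro _ ⟨v, rfl⟩
    rw [mulVecRight_apply, mulVec_eq_sum]
    exact Submodule.sum_mem _ fun i _ =>
      Submodule.smul_mem _ _ (Submodule.subset_span (Set.mem_range_self i))
  · rw [Submodule.span_le]
    rintro _ ⟨j, rfl⟩
    exact ⟨Pi.single j 1, by simp⟩

theorem rank_eq_finrank_range (A : Matrix m n ℍ[ℝ]) :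
    rank A = Module.finrank ℍ[ℝ]ᵐᵒᵖ (LinearMap.range (mulVecRight A)) := by
  rw [rank, range_mulVecRight]

/-- Project the column space of the block matrix onto the lower coordinates. The image is the column
space of `B`; the kernel consists of all `C u + A v` with `B u = 0` and contains the column space of
`A`. By rank-nullity, the ranks add up exactly when this inclusion is an equality. -/
theorem rank_fromBlocks_zero_eq_add_iff [Finite m] [Finite p] (A : Matrix m n ℍ[ℝ])
    (B : Matrix p q ℍ[ℝ]) (C : Matrix m q ℍ[ℝ]) :
    rank (fromBlocks C A B 0) = rank A + rank B ↔
      ∀ u, B *ᵥ u = 0 → ∃ v, A *ᵥ v = C *ᵥ u := by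
  classical
  have := Fintype.ofFinite m
  have := Fintype.ofFinite p
  set W := LinearMap.range (mulVecRight (fromBlocks C A B 0)) with hW
  let inl : (m → ℍ[ℝ]) →ₗ[ℍ[ℝ]ᵐᵒᵖ] (m ⊕ p → ℍ[ℝ]) :=
    { toFun := fun x => Sum.elim x 0
      map_add' := fun x y => by ext (i | i) <;> simp
      map_smul' := fun c x => by ext (i | i) <;> simp }
  have hinl : ∀ x, inl x = Sum.elim x 0 := fun _ => rfl
  let snd : (m ⊕ p → ℍ[ℝ]) →ₗ[ℍ[ℝ]ᵐᵒᵖ] (p → ℍ[ℝ]) := LinearMap.funLeft _ _ Sum.inr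
  have hsnd : ∀ x, snd x = x ∘ Sum.inr := fun _ => rfl
  have hmem : ∀ x, x ∈ W.comap inl ↔ ∃ u v, B *ᵥ u = 0 ∧ C *ᵥ u + A *ᵥ v = x := by
    intro x
    rw [Submodule.mem_comap, hinl, hW, LinearMap.mem_range]
    constructor
    · rintro ⟨w, hw⟩
      rw [mulVecRight_apply, fromBlocks_mulVec, Sum.elim_eq_iff] at hw
      exact ⟨_, _, by simpa using hw.2, hw.1⟩
    · rintro ⟨u, v, hu, rfl⟩
      exact ⟨Sum.elim u v, by simp [fromBlocks_mulVec, hu]⟩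
  have hrange : LinearMap.range (snd.domRestrict W) = LinearMap.range (mulVecRight B) := by
    rw [LinearMap.range_domRestrict, hW, ← LinearMap.range_comp]
    apply le_antisymm
    · rintro _ ⟨w, rfl⟩
      exact ⟨w ∘ Sum.inl, by simp [hsnd, fromBlocks_mulVec]⟩
    · rintro _ ⟨u, rfl⟩
      exact ⟨Sum.elim u 0, by simp [hsnd, fromBlocks_mulVec]⟩
  have hker : Module.finrank ℍ[ℝ]ᵐᵒᵖ (LinearMap.ker (snd.domRestrict W)) =
      Module.finrank ℍ[ℝ]ᵐᵒᵖ (W.comap inl) := by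
    refine LinearEquiv.finrank_eq (LinearEquiv.symm (LinearEquiv.ofBijective
      (LinearMap.codRestrict _ ((inl.domRestrict (W.comap inl)).codRestrict W fun x => x.2) ?_)
      ⟨?_, ?_⟩))
    · intro x
      exact LinearMap.mem_ker.2 rfl
    · intro x y h
      exact Subtype.ext (funext fun i =>
        congrFun (congrArg (fun z => (z.1.1 : m ⊕ p → ℍ[ℝ])) h) (Sum.inl i))
    · rintro ⟨⟨x, hx⟩, hx'⟩
      have hx2 : x = inl (x ∘ Sum.inl) := by
        ext1 (i | i)
        · rfl
        · exact congrFun (LinearMap.mem_ker.1 hx') i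
      exact ⟨⟨x ∘ Sum.inl, by rwa [Submodule.mem_comap, ← hx2]⟩,
        Subtype.ext (Subtype.ext hx2.symm)⟩
  have hle : LinearMap.range (mulVecRight A) ≤ W.comap inl := by
    rintro _ ⟨v, rfl⟩
    exact (hmem _).2 ⟨0, v, by simp, by simp⟩
  have hdim := (snd.domRestrict W).finrank_range_add_finrank_ker
  rw [hrange, hker, ← rank_eq_finrank_range, hW, ← rank_eq_finrank_range, ← hW] at hdim
  rw [← hdim, add_comm (rank A), add_right_inj]
  constructor
  · intro h u hu
    rw [rank_eq_finrank_range] at h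
    rw [← Submodule.eq_of_le_of_finrank_eq hle h.symm] at hmem
    exact (hmem (C *ᵥ u)).2 ⟨u, 0, hu, by simp⟩
  · intro h
    rw [rank_eq_finrank_range, le_antisymm (fun x hx => ?_) hle]
    obtain ⟨u, v, hu, rfl⟩ := (hmem x).1 hx
    obtain ⟨v', hv'⟩ := h u hu
    exact ⟨v' + v, by simp [mulVec_add, hv']⟩

end Rank

set_option linter.unusedSectionVars false

/-! ### Moore–Penrose identities and the two projectors -/

section Penrose

variable {l m n : Type*} [Fintype m] [Fintype n]

theorem mul_mpInv_mul (A : Matrix m n ℍ[ℝ]) : A * (A† * A) = A := by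
  rw [← Matrix.mul_assoc, (isMoorePenrose_mpInv A).mul_mul_self]

theorem mpInv_mul_mpInv (A : Matrix m n ℍ[ℝ]) : A† * (A * A†) = A† := by
  rw [← Matrix.mul_assoc, (isMoorePenrose_mpInv A).mul_mul_inv]

theorem mul_mpInv_mul_assoc (A : Matrix m n ℍ[ℝ]) (X : Matrix n l ℍ[ℝ]) :
    A * (A† * (A * X)) = A * X := by
  rw [← Matrix.mul_assoc A†, ← Matrix.mul_assoc A, mul_mpInv_mul]

/-- Since `A A†` is Hermitian, `A† = A† (A†)ᴴ Aᴴ`, and `Aᴴ P = (P A)ᴴ = Aᴴ`. From here on the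
Hermitian Penrose equations serve only this absorption rule and its mirror image. -/
theorem mpInv_mul_eq_of_isHermitian {A : Matrix m n ℍ[ℝ]} {P : Matrix m m ℍ[ℝ]} (hP : Pᴴ = P)
    (h : P * A = A) : A† * P = A† := by
  have hA := (isMoorePenrose_mpInv A).conjTranspose_self_mul
  rw [conjTranspose_mul] at hA
  have h' : Aᴴ * P = Aᴴ := by
    conv_rhs => rw [← h, conjTranspose_mul, hP]
  rw [← mpInv_mul_mpInv A, ← hA]
  simp only [Matrix.mul_assoc, h']

theorem mul_mpInv_eq_of_isHermitian {A : Matrix m n ℍ[ℝ]} {P : Matrix n n ℍ[ℝ]} (hP : Pᴴ = P)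
    (h : A * P = A) : P * A† = A† := by
  have hA := (isMoorePenrose_mpInv A).conjTranspose_mul_self
  rw [conjTranspose_mul] at hA
  have h' : P * Aᴴ = Aᴴ := by
    conv_rhs => rw [← h, conjTranspose_mul, hP]
  rw [← mpInv_mul_mpInv A, ← Matrix.mul_assoc A†, ← hA]
  simp only [← Matrix.mul_assoc, h']

variable [DecidableEq m] [DecidableEq n]

theorem projR_mul_self (A : Matrix m n ℍ[ℝ]) : projR A * A = 0 := by
  simp [projR, Matrix.sub_mul, Matrix.mul_assoc, mul_mpInv_mul]

theorem mul_projL_self (A : Matrix m n ℍ[ℝ]) : A * projL A = 0 := by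
  simp [projL, Matrix.mul_sub, mul_mpInv_mul]

theorem projR_mul_self_assoc (A : Matrix m n ℍ[ℝ]) (X : Matrix n l ℍ[ℝ]) :
    projR A * (A * X) = 0 := by
  rw [← Matrix.mul_assoc, projR_mul_self, Matrix.zero_mul]

theorem mul_projL_self_assoc (A : Matrix m n ℍ[ℝ]) (X : Matrix n l ℍ[ℝ]) :
    A * (projL A * X) = 0 := by
  rw [← Matrix.mul_assoc, mul_projL_self, Matrix.zero_mul]

theorem mul_projR_of_mul_eq_zero {A : Matrix m n ℍ[ℝ]} {P : Matrix l m ℍ[ℝ]} (h : P * A = 0) :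
    P * projR A = P := by
  simp [projR, Matrix.mul_sub, ← Matrix.mul_assoc, h]

theorem projL_mul_of_mul_eq_zero {A : Matrix m n ℍ[ℝ]} {Q : Matrix n l ℍ[ℝ]} (h : A * Q = 0) :
    projL A * Q = Q := by
  simp [projL, Matrix.sub_mul, Matrix.mul_assoc, h]

theorem mul_mpInv_mul_of_projR_mul_eq_zero {A : Matrix m n ℍ[ℝ]} {C : Matrix m l ℍ[ℝ]}
    (h : projR A * C = 0) : A * (A† * C) = C := by
  rw [projR, Matrix.sub_mul, Matrix.one_mul, sub_eq_zero, Matrix.mul_assoc] at h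
  exact h.symm

theorem mul_mpInv_mul_of_mul_projL_eq_zero {A : Matrix m n ℍ[ℝ]} {C : Matrix l n ℍ[ℝ]}
    (h : C * projL A = 0) : C * (A† * A) = C := by
  rw [projL, Matrix.mul_sub, Matrix.mul_one, sub_eq_zero] at h
  exact h.symm

theorem conjTranspose_projR (A : Matrix m n ℍ[ℝ]) : (projR A)ᴴ = projR A := by
  rw [projR, conjTranspose_sub, conjTranspose_one,
    (isMoorePenrose_mpInv A).conjTranspose_self_mul]

theorem conjTranspose_projL (A : Matrix m n ℍ[ℝ]) : (projL A)ᴴ = projL A := by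
  rw [projL, conjTranspose_sub, conjTranspose_one,
    (isMoorePenrose_mpInv A).conjTranspose_mul_self]

theorem projR_mul_projR (A : Matrix m n ℍ[ℝ]) : projR A * projR A = projR A :=
  mul_projR_of_mul_eq_zero (projR_mul_self A)

theorem projL_mul_projL (A : Matrix m n ℍ[ℝ]) : projL A * projL A = projL A :=
  projL_mul_of_mul_eq_zero (mul_projL_self A)

end Penrose

/-! ### Explicit solutions of linear matrix equations -/

section Equations

variable {k l m n k' l' : Type*} [Fintype k] [Fintype l] [Fintype m] [Fintype n]
  [Fintype k'] [Fintype l'] [DecidableEq k] [DecidableEq l] [DecidableEq m] [DecidableEq n]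
  [DecidableEq k'] [DecidableEq l']

/-! ### The equation `A X - Y B = C` -/

section Sylvester

variable {A : Matrix m k ℍ[ℝ]} {B : Matrix l n ℍ[ℝ]} {C : Matrix m n ℍ[ℝ]}

theorem sylvester_of_projR_mul_mul_projL_eq_zero (h : projR A * C * projL B = 0)
    (U : Matrix k l ℍ[ℝ]) (V : Matrix m l ℍ[ℝ]) (W : Matrix k n ℍ[ℝ]) :
    A * (A† * C + U * B + projL A * W) - (-(projR A) * C * B† + A * U + V * projR B) * B = C := by
  have h' : projR A * (C * (B† * B)) = projR A * C := by
    rw [← Matrix.mul_assoc]; exact mul_mpInv_mul_of_mul_projL_eq_zero h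
  simp only [Matrix.mul_add, Matrix.add_mul, Matrix.mul_assoc, Matrix.neg_mul, projR_mul_self,
    mul_projL_self_assoc, h', Matrix.mul_zero]
  simp only [projR, Matrix.sub_mul, Matrix.one_mul, Matrix.mul_assoc]
  abel

variable {X : Matrix k n ℍ[ℝ]} {Y : Matrix m l ℍ[ℝ]}

theorem projR_mul_mul_projL_eq_zero_of_sylvester (h : A * X - Y * B = C) :
    projR A * C * projL B = 0 := by
  rw [← h, Matrix.mul_sub, projR_mul_self_assoc, Matrix.sub_mul, Matrix.mul_assoc,
    Matrix.mul_assoc, mul_projL_self]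
  simp

/-- A solution is recovered with `U = A† Y`, `V = R_A Y`, `W = X`; the companion formula for `Y`
uses the same `U` and `V`. -/
theorem left_eq_of_sylvester (h : A * X - Y * B = C) :
    X = A† * C + A† * Y * B + projL A * X := by
  simp only [← h, projL, Matrix.sub_mul, Matrix.mul_sub, Matrix.one_mul, Matrix.mul_assoc]
  abel

theorem right_eq_of_sylvester (h : A * X - Y * B = C) :
    Y = -(projR A) * C * B† + A * (A† * Y) + projR A * Y * projR B := by
  rw [← h, Matrix.neg_mul, Matrix.mul_sub, projR_mul_self_assoc]
  simp only [projR, Matrix.sub_mul, Matrix.mul_sub, Matrix.one_mul, Matrix.mul_one, zero_sub,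
    neg_neg, Matrix.mul_assoc]
  abel

end Sylvester

theorem sylvester_add_of_projR_mul_mul_projL_eq_zero {A : Matrix m k ℍ[ℝ]} {B : Matrix l n ℍ[ℝ]}
    {C : Matrix m n ℍ[ℝ]} (h : projR A * C * projL B = 0)
    (U : Matrix m l ℍ[ℝ]) (V : Matrix k n ℍ[ℝ]) (W : Matrix m l ℍ[ℝ]) :
    A * (A† * C - A† * U * B + projL A * V) + (projR A * C * B† + A * A† * U + W * projR B) * B
      = C := by
  have h' : projR A * (C * (B† * B)) = projR A * C := by
    rw [← Matrix.mul_assoc]; exact mul_mpInv_mul_of_mul_projL_eq_zero h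
  simp only [Matrix.mul_add, Matrix.mul_sub, Matrix.add_mul, Matrix.mul_assoc, projR_mul_self,
    mul_projL_self_assoc, h', Matrix.mul_zero]
  simp only [projR, Matrix.sub_mul, Matrix.one_mul, Matrix.mul_assoc]
  abel

theorem left_eq_of_sylvester_add {A : Matrix m k ℍ[ℝ]} {B : Matrix l n ℍ[ℝ]}
    {C : Matrix m n ℍ[ℝ]} {X : Matrix k n ℍ[ℝ]} {Y : Matrix m l ℍ[ℝ]} (h : A * X + Y * B = C) :
    X = A† * C - A† * Y * B + projL A * X := by
  simp only [← h, projL, Matrix.sub_mul, Matrix.mul_add, Matrix.one_mul, Matrix.mul_assoc]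
  abel

theorem right_eq_of_sylvester_add {A : Matrix m k ℍ[ℝ]} {B : Matrix l n ℍ[ℝ]}
    {C : Matrix m n ℍ[ℝ]} {X : Matrix k n ℍ[ℝ]} {Y : Matrix m l ℍ[ℝ]} (h : A * X + Y * B = C) :
    Y = projR A * C * B† + A * A† * Y + projR A * Y * projR B := by
  rw [← h, Matrix.mul_add, projR_mul_self_assoc, zero_add]
  simp only [projR, Matrix.sub_mul, Matrix.mul_sub, Matrix.one_mul, Matrix.mul_one,
    Matrix.mul_assoc]
  abel

/-! ### The equation `A X B = C` -/

theorem mul_mul_eq_of_projR_mul_eq_zero {A : Matrix m k ℍ[ℝ]} {B : Matrix l n ℍ[ℝ]}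
    {C : Matrix m n ℍ[ℝ]} (hA : projR A * C = 0) (hB : C * projL B = 0)
    (V W : Matrix k l ℍ[ℝ]) :
    A * (A† * C * B† + projL A * V + W * projR B) * B = C := by
  simp only [Matrix.mul_add, Matrix.add_mul, Matrix.mul_assoc, projR_mul_self,
    mul_projL_self_assoc, Matrix.mul_zero, mul_mpInv_mul_of_mul_projL_eq_zero hB,
    mul_mpInv_mul_of_projR_mul_eq_zero hA, add_zero]

theorem eq_of_mul_mul_eq {A : Matrix m k ℍ[ℝ]} {B : Matrix l n ℍ[ℝ]}
    {C : Matrix m n ℍ[ℝ]} {X : Matrix k l ℍ[ℝ]} (h : A * X * B = C) :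
    X = A† * C * B† + projL A * X + A† * A * X * projR B := by
  simp only [← h, projL, projR, Matrix.sub_mul, Matrix.mul_sub, Matrix.one_mul, Matrix.mul_one,
    Matrix.mul_assoc]
  abel

/-! ### The equation `A X B + C Y D = E` -/

section TwoSided

variable {A : Matrix m k ℍ[ℝ]} {B : Matrix l n ℍ[ℝ]} {C : Matrix m k' ℍ[ℝ]}
  {D : Matrix l' n ℍ[ℝ]} {E : Matrix m n ℍ[ℝ]} {M : Matrix m k' ℍ[ℝ]} {N : Matrix l' n ℍ[ℝ]}
  {S : Matrix m k' ℍ[ℝ]}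

/-- Multiplying by `R_A` on the left leaves `M Y D`, and by `L_B` on the right leaves `C Y N`; each
condition annihilates one end of one of these products. -/
theorem twoSided_solvability {X : Matrix k l ℍ[ℝ]} {Y : Matrix k' l' ℍ[ℝ]}
    (hM : M = projR A * C) (hN : N = D * projL B) (h : A * X * B + C * Y * D = E) :
    projR M * projR A * E = 0 ∧ E * projL B * projL N = 0 ∧
      projR A * E * projL D = 0 ∧ projR C * E * projL B = 0 := by
  have h1 : projR A * E = M * Y * D := by
    simp only [← h, hM, Matrix.mul_add, Matrix.mul_assoc, projR_mul_self_assoc, zero_add]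
  have h2 : E * projL B = C * Y * N := by
    simp only [← h, hN, Matrix.add_mul, Matrix.mul_assoc, mul_projL_self, Matrix.mul_zero,
      zero_add]
  refine ⟨?_, ?_, ?_, ?_⟩
  · rw [Matrix.mul_assoc, h1, Matrix.mul_assoc, projR_mul_self_assoc]
  · rw [h2, Matrix.mul_assoc, mul_projL_self, Matrix.mul_zero]
  · rw [h1, Matrix.mul_assoc, mul_projL_self, Matrix.mul_zero]
  · rw [Matrix.mul_assoc, h2, Matrix.mul_assoc, projR_mul_self_assoc]

theorem mpInv_mul_projR_of_eq (hM : M = projR A * C) : M† * projR A = M† :=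
  mpInv_mul_eq_of_isHermitian (conjTranspose_projR A)
    (by rw [hM, ← Matrix.mul_assoc, projR_mul_projR])

theorem projL_mul_mpInv_of_eq (hN : N = D * projL B) : projL B * N† = N† :=
  mul_mpInv_eq_of_isHermitian (conjTranspose_projL B)
    (by rw [hN, Matrix.mul_assoc, projL_mul_projL])

/-- Put `F = E - C M† E`. Then `R_A F = 0`, so the leading terms of `A X B` give `F B† B`. The `Z₁`
terms cancel because `A A† S = S`, and the two `S C† E N†` terms leave `S C† E L_B = F L_B`. The sum
is `F + C M† E = E`. -/
theorem twoSided_of_solvability (hM : M = projR A * C) (hN : N = D * projL B)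
    (hS : S = C * projL M) (h1 : projR M * projR A * E = 0) (h2 : E * projL B * projL N = 0)
    (h3 : projR A * E * projL D = 0) (h4 : projR C * E * projL B = 0)
    (Z₁ : Matrix k' l' ℍ[ℝ]) (Z₂ Z₃ : Matrix k l ℍ[ℝ]) (Z₄ Z₅ : Matrix k' l' ℍ[ℝ]) :
    A * (A† * E * B† - A† * C * M† * E * B† - A† * S * C† * E * N† * D * B†
        - A† * S * Z₁ * projR N * D * B† + projL A * Z₂ + Z₃ * projR B) * B
      + C * (M† * E * D† + S† * S * C† * E * N† + projL M * projL S * Z₄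
        + projL M * Z₁ * projR N + Z₅ * projR D) * D = E := by
  have hMR := mpInv_mul_projR_of_eq hM
  have hNL := projL_mul_mpInv_of_eq hN
  have hSL := projL_mul_mpInv_of_eq hS
  have hAS : projR A * S = 0 := by
    rw [hS, ← Matrix.mul_assoc, ← hM, mul_projL_self]
  have hAS' (Q : Matrix k' n ℍ[ℝ]) : A * (A† * (S * Q)) = S * Q := by
    rw [← Matrix.mul_assoc A, ← Matrix.mul_assoc (A * A†), Matrix.mul_assoc A,
      mul_mpInv_mul_of_projR_mul_eq_zero hAS]
  have hND : projR N * (D * (B† * B)) = projR N * D := by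
    have : D * (B† * B) = D - N := by rw [hN, projL, Matrix.mul_sub, Matrix.mul_one, sub_sub_cancel]
    rw [this, Matrix.mul_sub, projR_mul_self, sub_zero]
  have hCLM (Q : Matrix k' n ℍ[ℝ]) : C * (projL M * Q) = S * Q := by rw [hS, Matrix.mul_assoc]
  have hCS (Q : Matrix k' n ℍ[ℝ]) : C * (S† * (S * Q)) = S * Q := by
    rw [← hSL, Matrix.mul_assoc, hCLM, mul_mpInv_mul_assoc]
  have hMED : M† * (E * (D† * D)) = M† * E := by
    rw [← hMR, Matrix.mul_assoc, ← Matrix.mul_assoc _ E, mul_mpInv_mul_of_mul_projL_eq_zero h3,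
      Matrix.mul_assoc]
  have hENN : E * (N† * N) = E * projL B := by
    rw [← hNL, Matrix.mul_assoc, ← Matrix.mul_assoc E, mul_mpInv_mul_of_mul_projL_eq_zero h2]
  have hCC : C * (C† * (E * projL B)) = E * projL B :=
    mul_mpInv_mul_of_projR_mul_eq_zero (by rw [← Matrix.mul_assoc, h4])
  -- `C† E L_B` solves `C X = E L_B`, so `M` maps it to `R_A E L_B`.
  have hSE : S * (C† * (E * projL B)) = E * projL B - C * (M† * (E * projL B)) := by
    have hMC : M * (C† * (E * projL B)) = projR A * (E * projL B) := by
      rw [hM, Matrix.mul_assoc, hCC]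
    rw [← hCLM, projL, Matrix.sub_mul, Matrix.one_mul, Matrix.mul_sub, hCC, Matrix.mul_assoc M†,
      hMC, ← Matrix.mul_assoc M†, hMR]
  have hMME : C * (M† * E) - A * (A† * (C * (M† * E))) = E - A * (A† * E) := by
    have : M * (M† * (projR A * E)) = projR A * E :=
      mul_mpInv_mul_of_projR_mul_eq_zero (by rw [← Matrix.mul_assoc, h1])
    rw [← Matrix.mul_assoc M†, hMR, show M * (M† * E) = projR A * (C * (M† * E)) by
      rw [← Matrix.mul_assoc (projR A), ← hM]] at this
    simp only [projR, Matrix.sub_mul, Matrix.one_mul, Matrix.mul_assoc] at this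
    exact this
  have hleft : A * (A† * E * B† - A† * C * M† * E * B† - A† * S * C† * E * N† * D * B†
        - A† * S * Z₁ * projR N * D * B† + projL A * Z₂ + Z₃ * projR B) * B =
      A * (A† * (E * (B† * B))) - A * (A† * (C * (M† * (E * (B† * B)))))
        - S * (C† * (E * (N† * (D * (B† * B))))) - S * (Z₁ * (projR N * D)) := by
    simp only [Matrix.mul_add, Matrix.mul_sub, Matrix.add_mul, Matrix.sub_mul, Matrix.mul_assoc,
      projR_mul_self, mul_projL_self_assoc, Matrix.mul_zero, hAS', hND, add_zero]
  have hright : C * (M† * E * D† + S† * S * C† * E * N† + projL M * projL S * Z₄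
        + projL M * Z₁ * projR N + Z₅ * projR D) * D =
      C * (M† * E) + S * (C† * (E * (N† * D))) + S * (Z₁ * (projR N * D)) := by
    simp only [Matrix.mul_add, Matrix.add_mul, Matrix.mul_assoc, hMED, hCS, hCLM,
      mul_projL_self_assoc, projR_mul_self, Matrix.mul_zero, add_zero]
  -- The difference contains `D (1 - B† B) = N`, and `E N† N = E L_B`.
  have hdiff : S * (C† * (E * (N† * D))) - S * (C† * (E * (N† * (D * (B† * B))))) =
      E * projL B - C * (M† * (E * projL B)) := by
    rw [← hSE, ← hENN, hN, projL]
    simp only [Matrix.mul_sub, Matrix.mul_one]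
  have hMMB := congrArg (· * (B† * B)) hMME
  simp only [Matrix.sub_mul, Matrix.mul_assoc] at hMMB
  simp only [projL, Matrix.mul_sub, Matrix.mul_one] at hdiff
  rw [← sub_eq_zero] at hdiff hMMB ⊢
  rw [hleft, hright, ← add_zero (0 : Matrix m n ℍ[ℝ])]
  nth_rewrite 1 [← hdiff]
  rw [← hMMB]
  abel

/-- The parameters are `Z₁ = Y`, `Z₂ = X`, `Z₃ = A† A X`, `Z₄ = Y N N†`, `Z₅ = M† M Y`. Since `M† E
= M† M Y D` and `S C† E N† = S Y N N†`, `E` can be eliminated and the sums telescope; `L_M S† = S†`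
merges the `S† S` and `L_S` terms of `Y`. -/
theorem twoSided_left_right_eq {X : Matrix k l ℍ[ℝ]} {Y : Matrix k' l' ℍ[ℝ]}
    (hM : M = projR A * C) (hN : N = D * projL B) (hS : S = C * projL M)
    (h : A * X * B + C * Y * D = E) :
    X = A† * E * B† - A† * C * M† * E * B† - A† * S * C† * E * N† * D * B†
        - A† * S * Y * projR N * D * B† + projL A * X + A† * A * X * projR B ∧
      Y = M† * E * D† + S† * S * C† * E * N† + projL M * projL S * (Y * N * N†)
        + projL M * Y * projR N + M† * M * Y * projR D := by
  have hME : M† * E = M† * (M * (Y * D)) := by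
    have : projR A * E = M * (Y * D) := by
      simp only [← h, hM, Matrix.mul_add, Matrix.mul_assoc, projR_mul_self_assoc, zero_add]
    rw [← this, ← Matrix.mul_assoc, mpInv_mul_projR_of_eq hM]
  have hEN : E * N† = C * (Y * (N * N†)) := by
    have : E * projL B = C * (Y * N) := by
      simp only [← h, hN, Matrix.add_mul, Matrix.mul_assoc, mul_projL_self, Matrix.mul_zero,
        zero_add]
    rw [← Matrix.mul_assoc Y, ← Matrix.mul_assoc C, ← this, Matrix.mul_assoc,
      projL_mul_mpInv_of_eq hN]
  have hSC : S * (C† * C) = S := by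
    have hMC : M * (C† * C) = M := by rw [hM, Matrix.mul_assoc, mul_mpInv_mul]
    simp only [hS, projL, Matrix.mul_sub, Matrix.sub_mul, Matrix.mul_one, Matrix.mul_assoc,
      hMC, mul_mpInv_mul]
  have hSE : S * (C† * (E * N†)) = S * (Y * (N * N†)) := by
    rw [hEN, ← Matrix.mul_assoc C†, ← Matrix.mul_assoc S, hSC]
  have hLS : projL M * (S† * (S * (Y * (N * N†)))) = S† * (S * (Y * (N * N†))) := by
    rw [← Matrix.mul_assoc _ S†, projL_mul_mpInv_of_eq hS]
  constructor
  · have h0 : A† * (E * B†) = A† * (A * (X * (B * B†))) + A† * (C * (Y * (D * B†))) := by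
      simp only [← h, Matrix.add_mul, Matrix.mul_add, Matrix.mul_assoc]
    have h1 : A† * (C * (M† * (E * B†))) = A† * (C * (M† * (M * (Y * (D * B†))))) := by
      rw [← Matrix.mul_assoc M†, hME]
      simp only [Matrix.mul_assoc]
    have h2 : A† * (S * (C† * (E * (N† * (D * B†))))) =
        A† * (S * (Y * (N * (N† * (D * B†))))) := by
      have := congrArg (fun Q => A† * (Q * (D * B†))) hSE
      simpa only [Matrix.mul_assoc] using this
    have h3 : A† * (S * (Y * (D * B†))) =
        A† * (C * (Y * (D * B†))) - A† * (C * (M† * (M * (Y * (D * B†))))) := by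
      simp only [hS, projL, Matrix.mul_sub, Matrix.sub_mul, Matrix.one_mul, Matrix.mul_assoc]
    simp only [Matrix.mul_assoc, h0, h1, h2, projR, projL, Matrix.sub_mul, Matrix.mul_sub,
      Matrix.one_mul, Matrix.mul_one, h3]
    abel
  · have h1 : M† * (E * D†) = M† * (M * (Y * (D * D†))) := by
      rw [← Matrix.mul_assoc, hME]
      simp only [Matrix.mul_assoc]
    rw [show projL S = 1 - S† * S from rfl]
    simp only [Matrix.mul_assoc, h1, hSE, Matrix.sub_mul, Matrix.mul_sub, hLS, Matrix.one_mul]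
    simp only [projR, projL, Matrix.sub_mul, Matrix.mul_sub,
      Matrix.one_mul, Matrix.mul_one, Matrix.mul_assoc]
    abel

end TwoSided

/-! ### Rank conditions -/

/-- The columns of `L_B` span the kernel of `B`, and `R_A` vanishes exactly on the column space of
`A`. -/
theorem rank_fromBlocks_zero_eq_add_iff_projR_mul_mul_projL {A : Matrix m k ℍ[ℝ]}
    {B : Matrix l n ℍ[ℝ]} {C : Matrix m n ℍ[ℝ]} :
    rank (fromBlocks C A B 0) = rank A + rank B ↔ projR A * C * projL B = 0 := by
  rw [rank_fromBlocks_zero_eq_add_iff]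
  constructor
  · intro h
    refine Matrix.ext_of_mulVec_single fun i => ?_
    obtain ⟨v, hv⟩ := h (projL B *ᵥ Pi.single i 1)
      (by simp only [mulVec_mulVec, mul_projL_self, zero_mulVec])
    simp only [← mulVec_mulVec]
    rw [← hv, mulVec_mulVec, projR_mul_self, zero_mulVec, zero_mulVec]
  · intro h u hu
    refine ⟨A† *ᵥ (C *ᵥ u), ?_⟩
    have hu' : projL B *ᵥ u = u := by
      rw [projL, sub_mulVec, one_mulVec, ← mulVec_mulVec, hu, mulVec_zero, sub_zero]
    have h' := congrArg (· *ᵥ u) h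
    simp only [← mulVec_mulVec, hu', zero_mulVec] at h'
    rw [projR, sub_mulVec, one_mulVec, sub_eq_zero, ← mulVec_mulVec] at h'
    exact h'.symm

theorem rank_fromBlocks_zero_eq_add_of_sylvester {A : Matrix m k ℍ[ℝ]} {B : Matrix l n ℍ[ℝ]}
    {C : Matrix m n ℍ[ℝ]} (X : Matrix k n ℍ[ℝ]) (Y : Matrix m l ℍ[ℝ]) (h : A * X - Y * B = C) :
    rank (fromBlocks C A B 0) = rank A + rank B :=
  rank_fromBlocks_zero_eq_add_iff_projR_mul_mul_projL.2
    (projR_mul_mul_projL_eq_zero_of_sylvester h)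

/-- Annihilators factor through the projectors: `P = P R_A` and `Q = L_B Q`. -/
theorem mul_mul_eq_zero_of_rank_fromBlocks {i j : Type*} {A : Matrix m k ℍ[ℝ]}
    {B : Matrix l n ℍ[ℝ]} {C : Matrix m n ℍ[ℝ]}
    (h : rank (fromBlocks C A B 0) = rank A + rank B) {P : Matrix i m ℍ[ℝ]} (hP : P * A = 0)
    {Q : Matrix n j ℍ[ℝ]} (hQ : B * Q = 0) : P * C * Q = 0 := by
  rw [rank_fromBlocks_zero_eq_add_iff_projR_mul_mul_projL] at h
  rw [← mul_projR_of_mul_eq_zero hP, ← projL_mul_of_mul_eq_zero hQ, Matrix.mul_assoc P,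
    Matrix.mul_assoc P, ← Matrix.mul_assoc _ _ Q, h, Matrix.zero_mul, Matrix.mul_zero]

end Equations

end QuatMatrix

/-! ### The mirror system and the analysis of one half -/

namespace CoupledSystem

variable {a₁ a₂ a₃ a₄ a₅ b₁ b₂ b₃ b₄ b₅ : ℕ}
variable (s : CoupledSystem a₁ a₂ a₃ a₄ a₅ b₁ b₂ b₃ b₄ b₅)

/-- The same system read from its last equation to its first one. -/
def swap : CoupledSystem a₅ a₄ a₃ a₂ a₁ b₅ b₄ b₃ b₂ b₁ where
  A₁ := s.A₄
  B₁ := s.B₄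
  C₁ := s.C₄
  A₂ := s.A₃
  B₂ := s.B₃
  C₂ := s.C₃
  A₃ := s.A₂
  B₃ := s.B₂
  C₃ := s.C₂
  A₄ := s.A₁
  B₄ := s.B₁
  C₄ := s.C₁

/-! ### The first two equations -/

/-- The right-hand side of `A₂ A₁ U₁ - X₃ B₂ = K`, the second equation after the first one has been
solved for `X₂` with parameters `U₁` and `V`. -/
noncomputable def rhs (V : Matrix (Fin a₂) (Fin b₂) ℍ[ℝ]) : Matrix (Fin a₃) (Fin b₂) ℍ[ℝ] :=
  s.C₂ + s.A₂ * projR s.A₁ * s.C₁ * s.B₁† - s.A₂ * V * projR s.B₁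

/-- The general solution of `A₁₁ V B₁₁ = C₁₁`. -/
noncomputable def V (W₂ W₃ : Matrix (Fin a₂) (Fin b₂) ℍ[ℝ]) : Matrix (Fin a₂) (Fin b₂) ℍ[ℝ] :=
  s.A₁₁† * s.C₁₁ * s.B₁₁† + projL s.A₁₁ * W₂ + W₃ * projR s.B₁₁

/-- The contribution of the first two equations to `E₁`. -/
noncomputable def halfE₁ : Matrix (Fin a₃) (Fin b₃) ℍ[ℝ] :=
  projR (s.A₂ * s.A₁) * s.C₂ * s.B₂† + s.A₁₁ * projR s.A₁ * s.C₁ * s.B₁† * s.B₂†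
    - s.C₁₁ * s.B₁₁† * projR s.B₁ * s.B₂†

theorem E₁_eq_sub : s.E₁ = s.halfE₁ - s.swap.halfE₁ := by
  change s.E₁ = s.halfE₁ - (projR (s.A₃ * s.A₄) * s.C₃ * s.B₃†
    + s.A₂₂ * projR s.A₄ * s.C₄ * s.B₄† * s.B₃† - s.C₂₂ * s.B₂₂† * projR s.B₄ * s.B₃†)
  rw [E₁, halfE₁]
  abel

/-- Solvability of the second equation in `U` and `X₃` thus becomes `A₁₁ V B₁₁ = C₁₁`. -/
theorem projR_mul_rhs_mul_projL (V : Matrix (Fin a₂) (Fin b₂) ℍ[ℝ]) :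
    projR (s.A₂ * s.A₁) * s.rhs V * projL s.B₂ = s.C₁₁ - s.A₁₁ * V * s.B₁₁ := by
  simp only [rhs, C₁₁, A₁₁, B₁₁, Matrix.mul_add, Matrix.mul_sub, Matrix.add_mul, Matrix.sub_mul,
    Matrix.mul_assoc]
  abel

variable {s}

/-- `A₁₁` annihilates the `W₂` term of `V`, so of the parameters of `V` only `W₃` reaches `X₃`. -/
theorem projR_mul_rhs_mul_mpInv (h : projR s.A₁₁ * s.C₁₁ = 0)
    (W₂ W₃ : Matrix (Fin a₂) (Fin b₂) ℍ[ℝ]) :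
    projR (s.A₂ * s.A₁) * s.rhs (s.V W₂ W₃) * s.B₂† = s.halfE₁ - s.A₁₁ * W₃ * s.A₄₄ := by
  have hV : s.A₁₁ * s.V W₂ W₃ = s.C₁₁ * s.B₁₁† + s.A₁₁ * W₃ * projR s.B₁₁ := by
    rw [V, Matrix.mul_add, Matrix.mul_add, mul_projL_self_assoc, add_zero, Matrix.mul_assoc s.A₁₁†,
      ← Matrix.mul_assoc _ s.C₁₁, ← Matrix.mul_assoc _ _ s.B₁₁†, ← Matrix.mul_assoc,
      Matrix.mul_assoc _ _ s.C₁₁, mul_mpInv_mul_of_projR_mul_eq_zero h, Matrix.mul_assoc]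
  have hV' := congrArg (· * (projR s.B₁ * s.B₂†)) hV
  simp only [A₁₁, Matrix.add_mul, Matrix.mul_assoc] at hV'
  simp only [rhs, halfE₁, A₄₄, A₁₁, Matrix.mul_add, Matrix.mul_sub, Matrix.add_mul, Matrix.sub_mul,
    Matrix.mul_assoc, hV']
  abel

theorem first_equations (h₁ : projR s.A₁ * s.C₁ * projL s.B₁ = 0)
    (hA : projR s.A₁₁ * s.C₁₁ = 0) (hB : s.C₁₁ * projL s.B₁₁ = 0)
    (W₁ : Matrix (Fin a₁) (Fin b₁) ℍ[ℝ]) (W₂ W₃ : Matrix (Fin a₂) (Fin b₂) ℍ[ℝ])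
    (W₄ : Matrix (Fin a₁) (Fin b₃) ℍ[ℝ]) (W₅ : Matrix (Fin a₃) (Fin b₃) ℍ[ℝ])
    (W₆ U : Matrix (Fin a₁) (Fin b₂) ℍ[ℝ])
    (hU : U = (s.A₂ * s.A₁)† * s.rhs (s.V W₂ W₃) + W₄ * s.B₂ + projL (s.A₂ * s.A₁) * W₆) :
    s.A₁ * (s.A₁† * s.C₁ + U * s.B₁ + projL s.A₁ * W₁)
        - (-(projR s.A₁) * s.C₁ * s.B₁† + s.A₁ * U + s.V W₂ W₃ * projR s.B₁) * s.B₁ = s.C₁ ∧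
      s.A₂ * (-(projR s.A₁) * s.C₁ * s.B₁† + s.A₁ * U + s.V W₂ W₃ * projR s.B₁)
        - (-(projR (s.A₂ * s.A₁)) * s.rhs (s.V W₂ W₃) * s.B₂† + s.A₂ * s.A₁ * W₄
          + W₅ * projR s.B₂) * s.B₂ = s.C₂ := by
  refine ⟨sylvester_of_projR_mul_mul_projL_eq_zero h₁ _ _ _, ?_⟩
  have h : projR (s.A₂ * s.A₁) * s.rhs (s.V W₂ W₃) * projL s.B₂ = 0 := by
    rw [projR_mul_rhs_mul_projL, V, mul_mul_eq_of_projR_mul_eq_zero hA hB, sub_self]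
  have h' := sylvester_of_projR_mul_mul_projL_eq_zero h W₄ W₅ W₆
  rw [← hU] at h'
  rw [sub_eq_iff_eq_add] at h'
  simp only [Matrix.mul_add, Matrix.mul_neg, Matrix.neg_mul, ← Matrix.mul_assoc] at h' ⊢
  rw [h', rhs]
  abel

theorem exists_of_first_equations {X₁ : Matrix (Fin a₁) (Fin b₁) ℍ[ℝ]}
    {X₂ : Matrix (Fin a₂) (Fin b₂) ℍ[ℝ]} {X₃ : Matrix (Fin a₃) (Fin b₃) ℍ[ℝ]}
    (h₁ : s.A₁ * X₁ - X₂ * s.B₁ = s.C₁) (h₂ : s.A₂ * X₂ - X₃ * s.B₂ = s.C₂) :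
    (projR s.A₁ * s.C₁ * projL s.B₁ = 0 ∧ projR s.A₁₁ * s.C₁₁ = 0 ∧ s.C₁₁ * projL s.B₁₁ = 0) ∧
    ∃ (W₁ : Matrix (Fin a₁) (Fin b₁) ℍ[ℝ]) (W₂ W₃ : Matrix (Fin a₂) (Fin b₂) ℍ[ℝ])
      (W₄ : Matrix (Fin a₁) (Fin b₃) ℍ[ℝ]) (W₅ : Matrix (Fin a₃) (Fin b₃) ℍ[ℝ])
      (W₆ U : Matrix (Fin a₁) (Fin b₂) ℍ[ℝ]),
      U = (s.A₂ * s.A₁)† * s.rhs (s.V W₂ W₃) + W₄ * s.B₂ + projL (s.A₂ * s.A₁) * W₆ ∧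
      X₁ = s.A₁† * s.C₁ + U * s.B₁ + projL s.A₁ * W₁ ∧
      X₂ = -(projR s.A₁) * s.C₁ * s.B₁† + s.A₁ * U + s.V W₂ W₃ * projR s.B₁ ∧
      X₃ = -(projR (s.A₂ * s.A₁)) * s.rhs (s.V W₂ W₃) * s.B₂† + s.A₂ * s.A₁ * W₄
          + W₅ * projR s.B₂ := by
  have hX₂ := right_eq_of_sylvester h₁
  set W := projR s.A₁ * X₂ with hW
  set U := s.A₁† * X₂ with hU
  have hK : s.A₂ * s.A₁ * U - X₃ * s.B₂ = s.rhs W := by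
    rw [rhs, ← h₂]
    conv_rhs => rw [hX₂]
    simp only [Matrix.mul_add, Matrix.neg_mul, Matrix.mul_neg, Matrix.mul_assoc]
    abel
  have hC : s.A₁₁ * W * s.B₁₁ = s.C₁₁ := by
    have := projR_mul_mul_projL_eq_zero_of_sylvester hK
    rw [projR_mul_rhs_mul_projL, sub_eq_zero] at this
    exact this.symm
  have hV : s.V W (s.A₁₁† * s.A₁₁ * W) = W := (eq_of_mul_mul_eq hC).symm
  -- Each unknown supplies its own parameters: `X₁` for `W₁`, the pair `W`, `A₁₁† A₁₁ W` that makes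
  -- `V` equal to `W`, the two parts of `X₃` for `W₄` and `W₅`, and `U` for `W₆`.
  refine ⟨⟨projR_mul_mul_projL_eq_zero_of_sylvester h₁, ?_, ?_⟩,
    X₁, W, s.A₁₁† * s.A₁₁ * W, (s.A₂ * s.A₁)† * X₃, projR (s.A₂ * s.A₁) * X₃, U, U, ?_⟩
  · rw [← hC, Matrix.mul_assoc, projR_mul_self_assoc]
  · rw [← hC, Matrix.mul_assoc, mul_projL_self, Matrix.mul_zero]
  · rw [hV]
    exact ⟨left_eq_of_sylvester hK, left_eq_of_sylvester h₁, hX₂, right_eq_of_sylvester hK⟩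

/-- `R_{A₁₁} R_{A₂A₁}` annihilates `A₂`, which gives the first identity. For the second, `Q = L_{B₂}
L_{B₁₁}` satisfies `R_{B₁} Q = 0`, hence `Q = B₁ B₁† Q`, and `B₁† Q` lies in the kernel of `B₂ B₁`.
-/
theorem projector_conditions_of_rank
    (h₂ : rank (fromBlocks s.C₂ s.A₂ s.B₂ 0) = rank s.A₂ + rank s.B₂)
    (h₂₁ : rank (fromBlocks (s.A₂ * s.C₁ + s.C₂ * s.B₁) (s.A₂ * s.A₁) (s.B₂ * s.B₁) 0) =
      rank (s.A₂ * s.A₁) + rank (s.B₂ * s.B₁)) :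
    projR s.A₁₁ * s.C₁₁ = 0 ∧ s.C₁₁ * projL s.B₁₁ = 0 := by
  constructor
  · have hP : projR s.A₁₁ * projR (s.A₂ * s.A₁) * s.A₂ = 0 := by
      rw [Matrix.mul_assoc, ← A₁₁, projR_mul_self]
    simp only [C₁₁, Matrix.mul_add, Matrix.add_mul, ← Matrix.mul_assoc, hP, Matrix.zero_mul,
      mul_mul_eq_zero_of_rank_fromBlocks h₂ hP (mul_projL_self _), add_zero]
  · set Q := projL s.B₂ * projL s.B₁₁ with hQ
    have hBQ : s.B₁ * (s.B₁† * Q) = Q := by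
      apply mul_mpInv_mul_of_projR_mul_eq_zero
      rw [hQ, ← Matrix.mul_assoc, ← B₁₁, mul_projL_self]
    have h := mul_mul_eq_zero_of_rank_fromBlocks h₂₁ (projR_mul_self (s.A₂ * s.A₁))
      (Q := s.B₁† * Q) (by rw [Matrix.mul_assoc, hBQ, hQ, mul_projL_self_assoc])
    have hR : projR (s.A₂ * s.A₁) * (s.A₂ * projR s.A₁) = projR (s.A₂ * s.A₁) * s.A₂ := by
      rw [← Matrix.mul_assoc]
      exact mul_projR_of_mul_eq_zero (by rw [Matrix.mul_assoc, projR_mul_self])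
    have hR' := congrArg (· * (s.C₁ * (s.B₁† * Q))) hR
    simp only [Matrix.mul_assoc] at hR'
    rw [C₁₁, Matrix.mul_assoc, ← hQ]
    simp only [Matrix.mul_add, Matrix.add_mul, Matrix.mul_assoc, hR', hBQ] at h ⊢
    exact h

/-- `P` kills `A₁₁`, and by the rank equality also `C₁₁`, so only the `C₂` term survives. -/
theorem mul_halfE₁_mul_of_mul_A₂ {i j : Type*}
    (h₂ : rank (fromBlocks s.C₂ s.A₂ s.B₂ 0) = rank s.A₂ + rank s.B₂)
    {P : Matrix i (Fin a₃) ℍ[ℝ]} {Q : Matrix (Fin b₃) j ℍ[ℝ]} (hP : P * s.A₂ = 0)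
    (hQ : projR s.B₂ * Q = 0) :
    ∃ T : Matrix (Fin b₂) j ℍ[ℝ], s.B₂ * T = Q ∧ P * s.halfE₁ * Q = P * s.C₂ * T := by
  have hPR : P * projR (s.A₂ * s.A₁) = P :=
    mul_projR_of_mul_eq_zero (by rw [← Matrix.mul_assoc, hP, Matrix.zero_mul])
  have hPA : P * s.A₁₁ = 0 := by rw [A₁₁, ← Matrix.mul_assoc, hPR, hP]
  have hPC : P * s.C₁₁ = 0 := by
    have := mul_mul_eq_zero_of_rank_fromBlocks h₂ hP (mul_projL_self _)
    rw [C₁₁, ← Matrix.mul_assoc, ← Matrix.mul_assoc, hPR, Matrix.mul_add, Matrix.add_mul, this]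
    simp only [← Matrix.mul_assoc, hP, Matrix.zero_mul, add_zero]
  refine ⟨s.B₂† * Q, mul_mpInv_mul_of_projR_mul_eq_zero hQ, ?_⟩
  simp only [halfE₁, Matrix.mul_add, Matrix.mul_sub, ← Matrix.mul_assoc, hPR, hPA, hPC,
    Matrix.zero_mul, add_zero, sub_zero]

/-- With `u = B₂† Q`, the condition `A₄₄ Q = 0` places `R_{B₁} u` in the column space of `B₁₁ =
R_{B₁} L_{B₂}`. Hence `u` can be changed by an element of the kernel of `B₂` so as to lie in the
column space of `B₁`. The `C₁₁` term of `halfE₁` is precisely this change. -/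
theorem mul_halfE₁_mul_of_mul_A₂_mul_A₁ {i j : Type*}
    {P : Matrix i (Fin a₃) ℍ[ℝ]} {Q : Matrix (Fin b₃) j ℍ[ℝ]} (hP : P * (s.A₂ * s.A₁) = 0)
    (hQ : projR s.B₂ * Q = 0) (hQ' : s.A₄₄ * Q = 0) :
    ∃ T : Matrix (Fin b₁) j ℍ[ℝ], s.B₂ * s.B₁ * T = Q ∧
      P * s.halfE₁ * Q = P * (s.A₂ * s.C₁ + s.C₂ * s.B₁) * T := by
  have hPR := mul_projR_of_mul_eq_zero hP
  have hPA : P * s.A₁₁ = P * s.A₂ := by rw [A₁₁, ← Matrix.mul_assoc, hPR]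
  have hPAR : P * s.A₂ * projR s.A₁ = P * s.A₂ :=
    mul_projR_of_mul_eq_zero (by rw [Matrix.mul_assoc, hP])
  set u := s.B₂† * Q with hu
  have hBu : s.B₂ * u = Q := mul_mpInv_mul_of_projR_mul_eq_zero hQ
  set y := s.B₁₁† * (projR s.B₁ * u) with hy
  have hBy : s.B₁₁ * y = projR s.B₁ * u := mul_mpInv_mul_of_projR_mul_eq_zero (by
    rw [A₄₄, Matrix.mul_assoc, ← hu, Matrix.mul_assoc] at hQ'; exact hQ')
  set w := u - projL s.B₂ * y with hw
  have hBw : s.B₁ * (s.B₁† * w) = w := mul_mpInv_mul_of_projR_mul_eq_zero (by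
    rw [hw, Matrix.mul_sub, ← hBy, B₁₁, Matrix.mul_assoc, sub_self])
  refine ⟨s.B₁† * w, ?_, ?_⟩
  · rw [Matrix.mul_assoc, hBw, hw, Matrix.mul_sub, hBu, mul_projL_self_assoc, sub_zero]
  · have hC : s.C₁₁ * y = projR (s.A₂ * s.A₁) *
        (s.A₂ * projR s.A₁ * s.C₁ * s.B₁† + s.C₂) * (projL s.B₂ * y) := by
      rw [C₁₁, Matrix.mul_assoc]
    have hleft : P * s.halfE₁ * Q =
        P * (s.A₂ * projR s.A₁ * s.C₁ * s.B₁† + s.C₂) * w := by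
      have : s.halfE₁ * Q = projR (s.A₂ * s.A₁) *
          (s.A₂ * projR s.A₁ * s.C₁ * s.B₁† + s.C₂) * u - s.C₁₁ * y := by
        simp only [halfE₁, A₁₁, hy, hu, Matrix.mul_add, Matrix.add_mul, Matrix.sub_mul,
          Matrix.mul_assoc]
        abel
      rw [Matrix.mul_assoc, this, hC, ← Matrix.mul_sub, ← hw, ← Matrix.mul_assoc,
        ← Matrix.mul_assoc, hPR]
    rw [hleft, Matrix.mul_add, Matrix.add_mul]
    simp only [← Matrix.mul_assoc, hPAR]
    simp only [Matrix.mul_add, Matrix.add_mul, Matrix.mul_assoc, hBw]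

end CoupledSystem

/-! ### Rank equalities for equations sharing one unknown -/

namespace QuatMatrix

/-- Because `B T` and `B' T'` agree, the column `(T, -T')` is annihilated by `(B, B')`. -/
theorem sub_eq_zero_of_rank_fromBlocks_fromCols {i j k k' m l n n' : Type*} [Fintype k] [Fintype k']
    [Fintype m] [Fintype l] [Fintype n] [Fintype n'] [DecidableEq k] [DecidableEq k']
    [DecidableEq m] [DecidableEq l] [DecidableEq n] [DecidableEq n']
    {A : Matrix m k ℍ[ℝ]} {A' : Matrix m k' ℍ[ℝ]} {B : Matrix l n ℍ[ℝ]} {B' : Matrix l n' ℍ[ℝ]}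
    {C : Matrix m n ℍ[ℝ]} {C' : Matrix m n' ℍ[ℝ]}
    (h : rank (fromBlocks (fromCols C C') (fromCols A A') (fromCols B B') 0) =
      rank (fromCols A A') + rank (fromCols B B'))
    {P : Matrix i m ℍ[ℝ]} {Q : Matrix l j ℍ[ℝ]} (hA : P * A = 0) (hA' : P * A' = 0)
    {T : Matrix n j ℍ[ℝ]} {T' : Matrix n' j ℍ[ℝ]} (hT : B * T = Q) (hT' : B' * T' = Q) :
    P * C * T - P * C' * T' = 0 := by
  have := mul_mul_eq_zero_of_rank_fromBlocks h (P := P)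
    (by rw [mul_fromCols, hA, hA', fromCols_zero]) (Q := fromRows T (-T'))
    (by rw [fromCols_mul_fromRows, Matrix.mul_neg, hT, hT', add_neg_cancel])
  rwa [mul_fromCols, fromCols_mul_fromRows, Matrix.mul_neg, ← sub_eq_add_neg] at this

/-- With the common `Y`, the two equations form one Sylvester equation whose first unknown is block
diagonal. -/
theorem rank_fromBlocks_fromCols_of_sylvester {k k' m l n n' : Type*} [Fintype k] [Fintype k']
    [Fintype m] [Fintype l] [Fintype n] [Fintype n'] [DecidableEq k] [DecidableEq k']
    [DecidableEq m] [DecidableEq l] [DecidableEq n] [DecidableEq n']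
    {A : Matrix m k ℍ[ℝ]} {A' : Matrix m k' ℍ[ℝ]} {B : Matrix l n ℍ[ℝ]} {B' : Matrix l n' ℍ[ℝ]}
    {C : Matrix m n ℍ[ℝ]} {C' : Matrix m n' ℍ[ℝ]} {X : Matrix k n ℍ[ℝ]} {X' : Matrix k' n' ℍ[ℝ]}
    {Y : Matrix m l ℍ[ℝ]} (h : A * X - Y * B = C) (h' : A' * X' - Y * B' = C') :
    rank (fromBlocks (fromCols C C') (fromCols A A') (fromCols B B') 0) =
      rank (fromCols A A') + rank (fromCols B B') := by
  refine rank_fromBlocks_zero_eq_add_of_sylvester (fromBlocks X 0 0 X') Y ?_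
  rw [fromCols_mul_fromBlocks, mul_fromCols, sub_eq_add_neg, fromCols_neg, ← h, ← h']
  ext i (j | j) <;> simp [sub_eq_add_neg]

end QuatMatrix

/-! ### Consistency, rank equalities and projector identities -/

namespace CoupledSystem

variable {a₁ a₂ a₃ a₄ a₅ b₁ b₂ b₃ b₄ b₅ : ℕ}
variable {s : CoupledSystem a₁ a₂ a₃ a₄ a₅ b₁ b₂ b₃ b₄ b₅}

theorem rankConditions_of_consistent (h : s.Consistent) : s.RankConditions := by
  obtain ⟨X₁, X₂, X₃, X₄, X₅, h₁, h₂, h₃, h₄⟩ := h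
  -- `X₂` is eliminated: `A₂` times the first equation plus the second times `B₁`.
  have h₂₁ : s.A₂ * s.A₁ * X₁ - X₃ * (s.B₂ * s.B₁) = s.A₂ * s.C₁ + s.C₂ * s.B₁ := by
    simp only [← h₁, ← h₂, Matrix.mul_sub, Matrix.sub_mul, Matrix.mul_assoc]
    abel
  have h₃₄ : s.A₃ * s.A₄ * X₅ - X₃ * (s.B₃ * s.B₄) = s.A₃ * s.C₄ + s.C₃ * s.B₄ := by
    simp only [← h₃, ← h₄, Matrix.mul_sub, Matrix.sub_mul, Matrix.mul_assoc]
    abel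
  exact ⟨rank_fromBlocks_zero_eq_add_of_sylvester _ _ h₁,
    rank_fromBlocks_zero_eq_add_of_sylvester _ _ h₂,
    rank_fromBlocks_zero_eq_add_of_sylvester _ _ h₃,
    rank_fromBlocks_zero_eq_add_of_sylvester _ _ h₄,
    rank_fromBlocks_zero_eq_add_of_sylvester _ _ h₂₁,
    rank_fromBlocks_zero_eq_add_of_sylvester _ _ h₃₄,
    rank_fromBlocks_fromCols_of_sylvester h₂ h₃,
    rank_fromBlocks_fromCols_of_sylvester h₂₁ h₃₄,
    rank_fromBlocks_fromCols_of_sylvester h₂ h₃₄,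
    rank_fromBlocks_fromCols_of_sylvester h₂₁ h₃⟩

theorem mul_A₂_eq_mul_A₁₁ {i : Type*} {P : Matrix i (Fin a₃) ℍ[ℝ]} (h : P * (s.A₂ * s.A₁) = 0) :
    P * s.A₂ = P * s.A₁₁ := by
  rw [A₁₁, ← Matrix.mul_assoc, mul_projR_of_mul_eq_zero h]

theorem mul_A₃₃_eq_zero {i : Type*} {P : Matrix i (Fin a₃) ℍ[ℝ]} (h : P * s.A₃₃ = 0) :
    P * (s.A₂ * s.A₁) = 0 ∧ P * (s.A₃ * s.A₄) = 0 := by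
  rw [A₃₃, mul_fromCols, Matrix.mul_neg, ← fromCols_zero, fromCols_ext_iff, neg_eq_zero] at h
  exact h

theorem B₃₃_mul_eq_zero {j : Type*} {Q : Matrix (Fin b₃) j ℍ[ℝ]} (h : s.B₃₃ * Q = 0) :
    projR s.B₂ * Q = 0 ∧ projR s.B₃ * Q = 0 := by
  have h₁ := congrArg toRows₁ h
  have h₂ := congrArg toRows₂ h
  rw [B₃₃, fromRows_mul, toRows₁_fromRows] at h₁
  rw [B₃₃, fromRows_mul, toRows₂_fromRows, Matrix.neg_mul] at h₂
  exact ⟨h₁, neg_eq_zero.1 h₂⟩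

/-- Each half of `E₁` becomes `P C T`, with `C` and `T` belonging to the original or the composite
equation according to which side annihilates. Both `T`s map to the same `Q`, so each of the four
cases is one mixed rank equality. -/
theorem mul_E₁_mul_eq_zero {i j : Type*} (h : s.RankConditions) {P : Matrix i (Fin a₃) ℍ[ℝ]}
    {Q : Matrix (Fin b₃) j ℍ[ℝ]} (hP : P * s.A₃₃ = 0) (hQ : s.B₃₃ * Q = 0)
    (h₁ : P * s.A₁₁ = 0 ∨ s.A₄₄ * Q = 0) (h₂ : P * s.A₂₂ = 0 ∨ s.B₄₄ * Q = 0) :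
    P * s.E₁ * Q = 0 := by
  obtain ⟨-, hr₂, hr₃, -, -, -, hr₅, hr₆, hr₇, hr₈⟩ := h
  obtain ⟨hP₂, hP₃⟩ := mul_A₃₃_eq_zero hP
  obtain ⟨hQ₂, hQ₃⟩ := B₃₃_mul_eq_zero hQ
  rw [E₁_eq_sub, Matrix.mul_sub, Matrix.sub_mul]
  rcases h₁ with h₁ | h₁ <;> rcases h₂ with h₂ | h₂
  · rw [← mul_A₂_eq_mul_A₁₁ hP₂] at h₁
    replace h₂ := (mul_A₂_eq_mul_A₁₁ (s := s.swap) hP₃).trans h₂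
    obtain ⟨T, hT, hPT⟩ := mul_halfE₁_mul_of_mul_A₂ hr₂ h₁ hQ₂
    obtain ⟨T', hT', hPT'⟩ := mul_halfE₁_mul_of_mul_A₂ (s := s.swap) hr₃ h₂ hQ₃
    rw [hPT, hPT']
    exact sub_eq_zero_of_rank_fromBlocks_fromCols hr₅ h₁ h₂ hT hT'
  · rw [← mul_A₂_eq_mul_A₁₁ hP₂] at h₁
    obtain ⟨T, hT, hPT⟩ := mul_halfE₁_mul_of_mul_A₂ hr₂ h₁ hQ₂
    obtain ⟨T', hT', hPT'⟩ := mul_halfE₁_mul_of_mul_A₂_mul_A₁ (s := s.swap) hP₃ hQ₃ h₂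
    rw [hPT, hPT']
    exact sub_eq_zero_of_rank_fromBlocks_fromCols hr₇ h₁ hP₃ hT hT'
  · replace h₂ := (mul_A₂_eq_mul_A₁₁ (s := s.swap) hP₃).trans h₂
    obtain ⟨T, hT, hPT⟩ := mul_halfE₁_mul_of_mul_A₂_mul_A₁ hP₂ hQ₂ h₁
    obtain ⟨T', hT', hPT'⟩ := mul_halfE₁_mul_of_mul_A₂ (s := s.swap) hr₃ h₂ hQ₃
    rw [hPT, hPT']
    exact sub_eq_zero_of_rank_fromBlocks_fromCols hr₈ hP₂ h₂ hT hT'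
  · obtain ⟨T, hT, hPT⟩ := mul_halfE₁_mul_of_mul_A₂_mul_A₁ hP₂ hQ₂ h₁
    obtain ⟨T', hT', hPT'⟩ := mul_halfE₁_mul_of_mul_A₂_mul_A₁ (s := s.swap) hP₃ hQ₃ h₂
    rw [hPT, hPT']
    exact sub_eq_zero_of_rank_fromBlocks_fromCols hr₆ hP₂ hP₃ hT hT'

theorem projectorConditions_of_rankConditions (h : s.RankConditions) : s.ProjectorConditions := by
  -- The four conditions on `E` all have the form `P E Q = 0`; the projectors inside `E` are
  -- absorbed into `P` and `Q`.
  have hE {i j : Type} (P : Matrix i (Fin a₃) ℍ[ℝ]) (Q : Matrix (Fin b₃) j ℍ[ℝ])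
      (h₁ : P * s.A = 0 ∨ s.B * Q = 0) (h₂ : P * s.C = 0 ∨ s.D * Q = 0) : P * s.E * Q = 0 := by
    have := mul_E₁_mul_eq_zero h (P := P * projR s.A₃₃) (Q := projL s.B₃₃ * Q)
      (by rw [Matrix.mul_assoc, projR_mul_self, Matrix.mul_zero])
      (by rw [mul_projL_self_assoc])
      (by rwa [Matrix.mul_assoc, ← Matrix.mul_assoc s.A₄₄])
      (by
        rwa [C, Matrix.neg_mul, Matrix.mul_neg, neg_eq_zero, ← Matrix.mul_assoc, D,
          Matrix.mul_assoc s.B₄₄] at h₂)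
    simpa only [E, Matrix.mul_assoc] using this
  obtain ⟨h₁, h₂, h₃, h₄, h₂₁, h₃₄, -⟩ := h
  refine ⟨⟨rank_fromBlocks_zero_eq_add_iff_projR_mul_mul_projL.1 h₁,
    projector_conditions_of_rank h₂ h₂₁⟩,
    ⟨rank_fromBlocks_zero_eq_add_iff_projR_mul_mul_projL.1 h₄,
    projector_conditions_of_rank (s := s.swap) h₃ h₃₄⟩, ?_, ?_, ?_, ?_⟩
  · rw [← Matrix.mul_one (_ * s.E)]
    refine hE _ _ (Or.inl ?_) (Or.inl ?_)
    · rw [Matrix.mul_assoc, projR_mul_self, Matrix.mul_zero]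
    · rw [Matrix.mul_assoc, ← M, projR_mul_self]
  · rw [← Matrix.one_mul s.E, Matrix.mul_assoc]
    refine hE _ _ (Or.inr ?_) (Or.inr ?_)
    · rw [mul_projL_self_assoc]
    · rw [← Matrix.mul_assoc, ← N, mul_projL_self]
  · exact hE _ _ (Or.inl (projR_mul_self _)) (Or.inr (mul_projL_self _))
  · exact hE _ _ (Or.inr (mul_projL_self _)) (Or.inl (projR_mul_self _))

/-! ### Coupling the two halves -/

/-- The right-hand side of `A₃₃ G + H B₃₃ = F`, the equality of the two expressions for `X₃`. -/
noncomputable def couplingRhs (s : CoupledSystem a₁ a₂ a₃ a₄ a₅ b₁ b₂ b₃ b₄ b₅)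
    (W₃ : Matrix (Fin a₂) (Fin b₂) ℍ[ℝ]) (T₃ : Matrix (Fin a₄) (Fin b₄) ℍ[ℝ]) :
    Matrix (Fin a₃) (Fin b₃) ℍ[ℝ] :=
  s.E₁ - s.A₁₁ * W₃ * s.A₄₄ + s.A₂₂ * T₃ * s.B₄₄

theorem projR_mul_couplingRhs_mul_projL (W₃ : Matrix (Fin a₂) (Fin b₂) ℍ[ℝ])
    (T₃ : Matrix (Fin a₄) (Fin b₄) ℍ[ℝ]) :
    projR s.A₃₃ * s.couplingRhs W₃ T₃ * projL s.B₃₃ =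
      s.E - (s.A * W₃ * s.B + s.C * T₃ * s.D) := by
  simp only [couplingRhs, E, A, B, C, D, Matrix.mul_add, Matrix.mul_sub, Matrix.add_mul,
    Matrix.sub_mul, Matrix.neg_mul, Matrix.mul_assoc]
  abel

theorem A₃₃_mul_add_mul_B₃₃ (W₄ : Matrix (Fin a₁) (Fin b₃) ℍ[ℝ])
    (T₄ : Matrix (Fin a₅) (Fin b₃) ℍ[ℝ])
    (W₅ T₅ : Matrix (Fin a₃) (Fin b₃) ℍ[ℝ]) :
    s.A₃₃ * fromRows W₄ T₄ + fromCols W₅ T₅ * s.B₃₃ =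
      (s.A₂ * s.A₁ * W₄ + W₅ * projR s.B₂) - (s.A₃ * s.A₄ * T₄ + T₅ * projR s.B₃) := by
  rw [A₃₃, B₃₃, fromCols_mul_fromRows, fromCols_mul_fromRows, Matrix.neg_mul, Matrix.mul_neg]
  abel

/-- The `B₂†` and `B₃†` terms of the two expressions are, up to sign, the halves of `E₁` corrected
by `W₃` and `T₃`. -/
theorem third_unknown_eq_iff (hA : projR s.A₁₁ * s.C₁₁ = 0) (hA' : projR s.A₂₂ * s.C₂₂ = 0)
    (W₂ W₃ : Matrix (Fin a₂) (Fin b₂) ℍ[ℝ]) (T₂ T₃ : Matrix (Fin a₄) (Fin b₄) ℍ[ℝ])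
    (W₄ : Matrix (Fin a₁) (Fin b₃) ℍ[ℝ]) (T₄ : Matrix (Fin a₅) (Fin b₃) ℍ[ℝ])
    (W₅ T₅ : Matrix (Fin a₃) (Fin b₃) ℍ[ℝ]) :
    -(projR (s.A₂ * s.A₁)) * s.rhs (s.V W₂ W₃) * s.B₂† + s.A₂ * s.A₁ * W₄ + W₅ * projR s.B₂ =
        -(projR (s.A₃ * s.A₄)) * s.swap.rhs (s.swap.V T₂ T₃) * s.B₃† + s.A₃ * s.A₄ * T₄
          + T₅ * projR s.B₃ ↔
      s.A₃₃ * fromRows W₄ T₄ + fromCols W₅ T₅ * s.B₃₃ = s.couplingRhs W₃ T₃ := by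
  have h' : projR (s.A₃ * s.A₄) * s.swap.rhs (s.swap.V T₂ T₃) * s.B₃† =
      s.swap.halfE₁ - s.A₂₂ * T₃ * s.B₄₄ := projR_mul_rhs_mul_mpInv (s := s.swap) hA' T₂ T₃
  rw [A₃₃_mul_add_mul_B₃₃, couplingRhs, E₁_eq_sub]
  simp only [Matrix.neg_mul, projR_mul_rhs_mul_mpInv hA, h']
  rw [← sub_eq_zero, ← sub_eq_zero (b := _ + s.A₂₂ * T₃ * s.B₄₄)]
  refine Eq.congr ?_ rfl
  abel

variable (s) in
theorem fourth_parameters_eq (p : FreeParameters a₁ a₂ a₃ a₄ a₅ b₁ b₂ b₃ b₄ b₅) :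
    fromRows (s.W₄ p) (s.T₄ p) = s.A₃₃† * s.couplingRhs (s.W₃ p) (s.T₃ p)
      - s.A₃₃† * p.Z₇ * s.B₃₃ + projL s.A₃₃ * p.Z₆ := by
  rw [W₄, T₄, ← fromRows_mul, fromRows_fromCols_eq_fromBlocks, fromBlocks_one, Matrix.one_mul,
    couplingRhs]

variable (s) in
theorem fifth_parameters_eq (p : FreeParameters a₁ a₂ a₃ a₄ a₅ b₁ b₂ b₃ b₄ b₅) :
    fromCols (s.W₅ p) (s.T₅ p) = projR s.A₃₃ * s.couplingRhs (s.W₃ p) (s.T₃ p) * s.B₃₃†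
      + s.A₃₃ * s.A₃₃† * p.Z₇ + p.Z₈ * projR s.B₃₃ := by
  rw [W₅, T₅, ← mul_fromCols, fromCols_fromRows_eq_fromBlocks, fromBlocks_one, Matrix.mul_one,
    couplingRhs]

/-- `W₃` and `T₃` solve the two-sided equation, which is the solvability condition for the coupling;
the blocks of `G` and `H` then solve the coupling itself. -/
theorem X₃_eq_X₃Alt (h : s.ProjectorConditions)
    (p : FreeParameters a₁ a₂ a₃ a₄ a₅ b₁ b₂ b₃ b₄ b₅) : s.X₃ p = s.X₃Alt p := by
  obtain ⟨⟨-, hA, -⟩, ⟨-, hA', -⟩, h₁, h₂, h₃, h₄⟩ := h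
  refine (third_unknown_eq_iff hA hA' p.W₂ (s.W₃ p) p.T₂ (s.T₃ p) _ _ _ _).2 ?_
  rw [fourth_parameters_eq, fifth_parameters_eq]
  refine sylvester_add_of_projR_mul_mul_projL_eq_zero ?_ _ _ _
  rw [projR_mul_couplingRhs_mul_projL, sub_eq_zero, eq_comm]
  exact twoSided_of_solvability rfl rfl rfl h₁ h₂ h₃ h₄ _ _ _ _ _

theorem isSolution_of_projectorConditions (h : s.ProjectorConditions)
    (p : FreeParameters a₁ a₂ a₃ a₄ a₅ b₁ b₂ b₃ b₄ b₅) :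
    s.IsSolution (s.X₁ p) (s.X₂ p) (s.X₃ p) (s.X₄ p) (s.X₅ p) := by
  have hX := X₃_eq_X₃Alt h p
  obtain ⟨⟨h₁, hA, hB⟩, ⟨h₁', hA', hB'⟩, -⟩ := h
  obtain ⟨e₁, e₂⟩ := first_equations h₁ hA hB p.W₁ p.W₂ (s.W₃ p) (s.W₄ p) (s.W₅ p) p.W₆
    (s.U₁ p) rfl
  obtain ⟨e₄, e₃⟩ := first_equations (s := s.swap) h₁' hA' hB' p.T₁ p.T₂ (s.T₃ p) (s.T₄ p)
    (s.T₅ p) p.T₆ (s.U₂ p) rfl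
  refine ⟨e₁, e₂, ?_, e₄⟩
  rw [hX]
  exact e₃

theorem exists_parameters_of_isSolution {X₁ : Matrix (Fin a₁) (Fin b₁) ℍ[ℝ]}
    {X₂ : Matrix (Fin a₂) (Fin b₂) ℍ[ℝ]} {X₃ : Matrix (Fin a₃) (Fin b₃) ℍ[ℝ]}
    {X₄ : Matrix (Fin a₄) (Fin b₄) ℍ[ℝ]} {X₅ : Matrix (Fin a₅) (Fin b₅) ℍ[ℝ]}
    (h : s.IsSolution X₁ X₂ X₃ X₄ X₅) :
    s.ProjectorConditions ∧ ∃ p : FreeParameters a₁ a₂ a₃ a₄ a₅ b₁ b₂ b₃ b₄ b₅,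
      X₁ = s.X₁ p ∧ X₂ = s.X₂ p ∧ X₃ = s.X₃ p ∧ X₄ = s.X₄ p ∧ X₅ = s.X₅ p := by
  obtain ⟨h₁, h₂, h₃, h₄⟩ := h
  obtain ⟨hc, W₁, W₂, W₃, W₄, W₅, W₆, U₁, hU₁, hX₁, hX₂, hX₃⟩ := exists_of_first_equations h₁ h₂
  obtain ⟨hc', T₁, T₂, T₃, T₄, T₅, T₆, U₂, hU₂, hX₅, hX₄, hX₃'⟩ :=
    exists_of_first_equations (s := s.swap) h₄ h₃
  have hF := (third_unknown_eq_iff hc.2.1 hc'.2.1 W₂ W₃ T₂ T₃ W₄ T₄ W₅ T₅).1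
    (hX₃.symm.trans hX₃')
  have hE : s.A * W₃ * s.B + s.C * T₃ * s.D = s.E := by
    rw [eq_comm, ← sub_eq_zero, ← projR_mul_couplingRhs_mul_projL, ← hF, Matrix.mul_add,
      projR_mul_self_assoc, zero_add, Matrix.mul_assoc, Matrix.mul_assoc, mul_projL_self,
      Matrix.mul_zero, Matrix.mul_zero]
  obtain ⟨hW₃, hT₃⟩ := twoSided_left_right_eq (M := s.M) (N := s.N) (S := s.S) rfl rfl rfl hE
  -- `Z₁` to `Z₅` come from `twoSided_left_right_eq`; `Z₆`, `Z₇`, `Z₈` from the block solution of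
  -- the coupling, with `Z₈` its projection by `R_{A₃₃}`.
  let p : FreeParameters a₁ a₂ a₃ a₄ a₅ b₁ b₂ b₃ b₄ b₅ :=
    { W₁, W₂, W₆, T₁, T₂, T₆
      Z₁ := T₃
      Z₂ := W₃
      Z₃ := s.A† * s.A * W₃
      Z₄ := T₃ * s.N * s.N†
      Z₅ := s.M† * s.M * T₃
      Z₆ := fromRows W₄ T₄
      Z₇ := fromCols W₅ T₅
      Z₈ := projR s.A₃₃ * fromCols W₅ T₅ }
  have pW₃ : s.W₃ p = W₃ := hW₃.symm
  have pT₃ : s.T₃ p = T₃ := hT₃.symm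
  obtain ⟨pW₄, pT₄⟩ := (fromRows_ext_iff _ _ _ _).1 ((s.fourth_parameters_eq p).trans (by
    rw [pW₃, pT₃]; exact (left_eq_of_sylvester_add hF).symm))
  -- The `T₅` block is not needed, as `X₃` is matched with its first expression only.
  obtain ⟨pW₅, -⟩ := (fromCols_ext_iff _ _ _ _).1 ((s.fifth_parameters_eq p).trans (by
    rw [pW₃, pT₃]; exact (right_eq_of_sylvester_add hF).symm))
  have pV₁ : s.V₁ p = s.V W₂ W₃ := by rw [V₁, pW₃, V]
  have pV₂ : s.V₂ p = s.swap.V T₂ T₃ := by rw [V₂, pT₃]; rfl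
  have pU₁ : s.U₁ p = U₁ := by rw [CoupledSystem.U₁, pV₁, pW₄, hU₁, rhs]
  have pU₂ : s.U₂ p = U₂ := by rw [CoupledSystem.U₂, pV₂, pT₄, hU₂]; rfl
  refine ⟨⟨hc, hc', twoSided_solvability rfl rfl hE⟩, p, ?_, ?_, ?_, ?_, ?_⟩
  · rw [CoupledSystem.X₁, pU₁, hX₁]
  · rw [CoupledSystem.X₂, pU₁, pV₁, hX₂]
  · rw [CoupledSystem.X₃, pV₁, pW₄, pW₅, hX₃, rhs]
  · rw [CoupledSystem.X₄, pU₂, pV₂, hX₄]; rfl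
  · rw [CoupledSystem.X₅, pU₂, hX₅]; rfl

end CoupledSystem

/-! ### The equivalence and the general solution -/

theorem theorem5p1 {a₁ a₂ a₃ a₄ a₅ b₁ b₂ b₃ b₄ b₅ : ℕ}
    (s : CoupledSystem a₁ a₂ a₃ a₄ a₅ b₁ b₂ b₃ b₄ b₅) :
    [s.Consistent, s.RankConditions, s.ProjectorConditions].TFAE ∧
    (s.Consistent →
      (∀ X₁ X₂ X₃ X₄ X₅, s.IsSolution X₁ X₂ X₃ X₄ X₅ ↔
        ∃ p : FreeParameters a₁ a₂ a₃ a₄ a₅ b₁ b₂ b₃ b₄ b₅,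
          X₁ = s.X₁ p ∧ X₂ = s.X₂ p ∧ X₃ = s.X₃ p ∧ X₄ = s.X₄ p ∧ X₅ = s.X₅ p) ∧
      ∀ p : FreeParameters a₁ a₂ a₃ a₄ a₅ b₁ b₂ b₃ b₄ b₅, s.X₃ p = s.X₃Alt p) := by
  have hcons : s.Consistent → s.ProjectorConditions := by
    rintro ⟨_, _, _, _, _, h⟩
    exact (CoupledSystem.exists_parameters_of_isSolution h).1
  refine ⟨?_, fun hs => ⟨fun X₁ X₂ X₃ X₄ X₅ => ⟨fun h =>
    (CoupledSystem.exists_parameters_of_isSolution h).2, ?_⟩, CoupledSystem.X₃_eq_X₃Alt (hcons hs)⟩⟩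
  · tfae_have 1 → 2 := CoupledSystem.rankConditions_of_consistent
    tfae_have 2 → 3 := CoupledSystem.projectorConditions_of_rankConditions
    -- Any choice of parameters gives a solution; all are taken zero.
    tfae_have 3 → 1 := fun h => ⟨_, _, _, _, _,
      CoupledSystem.isSolution_of_projectorConditions h ⟨0, 0, 0, 0, 0, 0, 0, 0, 0, 0, 0, 0, 0, 0⟩⟩
    tfae_finish
  · rintro ⟨p, rfl, rfl, rfl, rfl, rfl⟩
    exact CoupledSystem.isSolution_of_projectorConditions (hcons hs) p
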